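/- Let $A\in\mathbb R^{n\times n}$ and $B\in\mathbb R^{n\times m}$ be such that all eigenvalues of $A$ lie in the closed left half plane and $(A,B)$ is stabilizable. Let $\sigma$ act componentwise by $\mathrm{sat}(w)=\mathrm{sgn}(w)\min(1,|w|)$. Consider $N$ agents and an exosystem $$\dot x_i=Ax_i+B\sigma(u_i),\quad i=1,\dots,N,\qquad \dot x_r=Ax_r .$$ For a node set $\mathscr C\subseteq\{1,\dots,N\}$ put $\iota_i=1$ if $i\in\mathscr C$ and $\iota_i=0$ otherwise, and let $\mathbb G_{\mathscr C}^N$ be the set of directed graphs on $\{1,\dots,N\}$ with weights $a_{ij}\ge 0$, $a_{ii}=0$ (there is an edge from $j$ to $i$ iff $a_{ij}>0$) in which every node belongs to a directed tree (a subgraph in which the root has no parent, every other node has exactly one parent, and the root has a directed path to every node) whose root is in $\mathscr C$. Agent $i$ receives $$\bar\zeta_i=\sum_{j=1}^N a_{ij}(x_i-x_j)+\iota_i(x_i-x_r),\qquad \hat\zeta_i=\sum_{j=1}^N a_{ij}(\xi_i-\xi_j),$$ where $\xi_i\in\mathbb R^n$ is produced by the protocol of agent $i$. Solutions are taken on $[0,\infty)$.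 (1) The scalable semi-global regulated state synchronization problem is solvable. That is, there are $n_c$ and a linear protocol with parameter $\varepsilon\in(0,1]$, $$\dot x_{c,i}=(A_c^\varepsilon+\iota_iJ_c^\varepsilon)x_{c,i}+B_c^\varepsilon u_i+C_c^\varepsilon\bar\zeta_i+D_c^\varepsilon\hat\zeta_i,\qquad u_i=F_c^\varepsilon x_{c,i},\qquad \xi_i=E_cx_{c,i},\qquad x_{c,i}\in\mathbb R^{n_c},$$ whose matrices are chosen independently of $N$, $\mathscr C$ and the graph, such that for all compact sets $\mathbb S_a,\mathbb S_e\subset\mathbb R^n$, $\mathbb S_c\subset\mathbb R^{n_c}$, all $N$, all $\mathscr C$ and all graphs in $\mathbb G_{\mathscr C}^N$ there is $\varepsilon^*\in(0,1]$ such that for all $\varepsilon\in(0,\varepsilon^*]$ and all initial conditions $x_i(0)\in\mathbb S_a$, $x_r(0)\in\mathbb S_e$, $x_{c,i}(0)\in\mathbb S_c$, a solution of the closed loop exists and every solution satisfies $\lim_{t\to\infty}(x_i(t)-x_r(t))=0$ for all $i$. (2) In particular, for each $\varepsilon>0$ the equation $A^{T}P_\varepsilon+P_\varepsilon A-P_\varepsilon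 BB^{T}P_\varepsilon+\varepsilon I=0$ has a unique positive definite solution $P_\varepsilon$, and for all compact sets $\mathbb S_a,\mathbb S_e,\mathbb S_c\subset\mathbb R^n$, all $N$, all $\mathscr C$ and all graphs in $\mathbb G_{\mathscr C}^N$ there is $\varepsilon^*\in(0,1]$ such that for all $\varepsilon\in(0,\varepsilon^*]$ and all initial conditions $x_i(0)\in\mathbb S_a$, $x_r(0)\in\mathbb S_e$, $\chi_i(0)\in\mathbb S_c$, the closed loop with the protocol $$\dot\chi_i=A\chi_i+Bu_i+\bar\zeta_i-\hat\zeta_i-\iota_i\chi_i,\qquad u_i=-B^{T}P_\varepsilon\chi_i,\qquad \xi_i=\chi_i,$$ has a solution, and every solution satisfies $\sigma(u_i(t))=u_i(t)$ for all $t\ge0$ and $\lim_{t\to\infty}(x_i(t)-x_r(t))=0$, for all $i$. -/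

import Mathlib

open scoped Matrix

noncomputable section

namespace RegSync

/-- The scalar standard saturation `sat w = sgn w * min (1, |w|)`. -/
def sat (w : ℝ) : ℝ := Real.sign w * min 1 |w|

/-- The componentwise saturation `σ` on `ℝ^m`. -/
def satVec {m : ℕ} (v : Fin m → ℝ) : Fin m → ℝ := fun k => sat (v k)

/-- All complex eigenvalues lie in the open left half plane. -/
def IsHurwitz {n : ℕ} (A : Matrix (Fin n) (Fin n) ℝ) : Prop :=
  ∀ z ∈ spectrum ℂ (A.map Complex.ofReal), z.re < 0

/-- All complex eigenvalues lie in the closed left half plane. -/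
def IsAtMostWeaklyUnstable {n : ℕ} (A : Matrix (Fin n) (Fin n) ℝ) : Prop :=
  ∀ z ∈ spectrum ℂ (A.map Complex.ofReal), z.re ≤ 0

/-- `(A, B)` is stabilizable: some static state feedback makes the closed loop Hurwitz. -/
def IsStabilizable {n m : ℕ} (A : Matrix (Fin n) (Fin n) ℝ) (B : Matrix (Fin n) (Fin m) ℝ) :
    Prop :=
  ∃ F : Matrix (Fin m) (Fin n) ℝ, IsHurwitz (A + B * F)

/-- `P` is a (symmetric) positive definite solution of `Aᵀ P + P A - P B Bᵀ P + ε I = 0`. -/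
def IsRiccatiSolution {n m : ℕ} (A : Matrix (Fin n) (Fin n) ℝ) (B : Matrix (Fin n) (Fin m) ℝ)
    (ε : ℝ) (P : Matrix (Fin n) (Fin n) ℝ) : Prop :=
  P.PosDef ∧ Aᵀ * P + P * A - P * B * Bᵀ * P + ε • (1 : Matrix (Fin n) (Fin n) ℝ) = 0

/-- A weighted directed graph on `N` nodes without self-loops, given by its weighted adjacency
matrix `a`; there is an edge from `j` to `i`, of weight `a i j`, exactly when `a i j > 0`. -/
structure WeightedGraph (N : ℕ) where
  a : Matrix (Fin N) (Fin N) ℝ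
  nonneg : ∀ i j, 0 ≤ a i j
  no_loop : ∀ i, a i i = 0

/-- There is an edge from node `j` to node `i`. -/
def WeightedGraph.Edge {N : ℕ} (G : WeightedGraph N) (j i : Fin N) : Prop := 0 < G.a i j

/-- The subgraph of `G` with node set `S` and edges `T` (`T j i` is an edge from `j` to `i`) is a
directed tree with root `r`: the root has no parent, every other node has exactly one parent, and
there is a directed path inside the tree from the root to every node of the tree. -/
structure WeightedGraph.IsDirectedTree {N : ℕ} (G : WeightedGraph N) (S : Set (Fin N))
    (T : Fin N → Fin N → Prop) (r : Fin N) : Prop where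
  root_mem : r ∈ S
  edge : ∀ j i, T j i → j ∈ S ∧ i ∈ S ∧ G.Edge j i
  root_no_parent : ∀ j, ¬ T j r
  unique_parent : ∀ i ∈ S, i ≠ r → ∃! j, T j i
  path : ∀ i ∈ S, Relation.ReflTransGen T r i

/-- The class of graphs with root set `C`: every node is a member of a directed tree (a subgraph
of `G`) whose root belongs to `C`. -/
def WeightedGraph.HasRootSet {N : ℕ} (G : WeightedGraph N) (C : Finset (Fin N)) : Prop :=
  ∀ i : Fin N, ∃ (S : Set (Fin N)) (T : Fin N → Fin N → Prop) (r : Fin N),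
    r ∈ C ∧ i ∈ S ∧ G.IsDirectedTree S T r

/-- `ι i = 1` if `i ∈ C`, and `0` otherwise. -/
def iota {N : ℕ} (C : Finset (Fin N)) (i : Fin N) : ℝ := if i ∈ C then 1 else 0

/-- The relative measurement `∑ j, a i j (x i - x j) + ι i (x i - xr)`. -/
def zetaBar {N n : ℕ} (G : WeightedGraph N) (C : Finset (Fin N)) (x : Fin N → Fin n → ℝ)
    (xr : Fin n → ℝ) (i : Fin N) : Fin n → ℝ :=
  ∑ j, G.a i j • (x i - x j) + iota C i • (x i - xr)

/-- The exchanged information `∑ j, a i j (ξ i - ξ j)`. -/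
def zetaHat {N n : ℕ} (G : WeightedGraph N) (ξ : Fin N → Fin n → ℝ) (i : Fin N) : Fin n → ℝ :=
  ∑ j, G.a i j • (ξ i - ξ j)

/-- A linear dynamic protocol, the same for all agents, for full-state coupling:
`xc' = Ac xc + ι Jc xc + Bc u + Cc ζBar + Dc ζHat`, `u = Fc xc`, `ξ = Ec xc`.
The term with `Jc` lets an agent use whether or not it has access to the exosystem. -/
structure LinearProtocol (n m nc : ℕ) where
  Ac : Matrix (Fin nc) (Fin nc) ℝ
  Jc : Matrix (Fin nc) (Fin nc) ℝ
  Bc : Matrix (Fin nc) (Fin m) ℝ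
  Cc : Matrix (Fin nc) (Fin n) ℝ
  Dc : Matrix (Fin nc) (Fin n) ℝ
  Ec : Matrix (Fin n) (Fin nc) ℝ
  Fc : Matrix (Fin m) (Fin nc) ℝ

/-- The low-gain protocol `χ' = A χ + B u + ζBar - ζHat - ι χ`, `u = -Bᵀ P χ`, `ξ = χ`. -/
def lowGainProtocol {n m : ℕ} (A : Matrix (Fin n) (Fin n) ℝ) (B : Matrix (Fin n) (Fin m) ℝ)
    (P : Matrix (Fin n) (Fin n) ℝ) : LinearProtocol n m n where
  Ac := A
  Jc := -1
  Bc := B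
  Cc := 1
  Dc := -1
  Ec := 1
  Fc := -(Bᵀ * P)

/-- `(x, xr, xc)` is a solution on `[0, ∞)`, with initial values `x₀, xr₀, xc₀`, of the closed
loop of the saturated agents `x i' = A (x i) + B σ(u i)`, the exosystem `xr' = A xr` and the
protocol `K` over the network. The derivative is one-sided at `0` and two-sided at `t > 0`. -/
structure IsClosedLoopSolution {N n m nc : ℕ} (A : Matrix (Fin n) (Fin n) ℝ)
    (B : Matrix (Fin n) (Fin m) ℝ) (K : LinearProtocol n m nc) (G : WeightedGraph N)
    (C : Finset (Fin N)) (x₀ : Fin N → Fin n → ℝ) (xr₀ : Fin n → ℝ) (xc₀ : Fin N → Fin nc → ℝ)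
    (x : Fin N → ℝ → Fin n → ℝ) (xr : ℝ → Fin n → ℝ) (xc : Fin N → ℝ → Fin nc → ℝ) : Prop where
  init_agent : ∀ i, x i 0 = x₀ i
  init_exo : xr 0 = xr₀
  init_protocol : ∀ i, xc i 0 = xc₀ i
  agent : ∀ i, ∀ t, 0 ≤ t →
    HasDerivWithinAt (x i) (A *ᵥ x i t + B *ᵥ satVec (K.Fc *ᵥ xc i t)) (Set.Ici 0) t
  exo : ∀ t, 0 ≤ t → HasDerivWithinAt xr (A *ᵥ xr t) (Set.Ici 0) t
  protocol : ∀ i, ∀ t, 0 ≤ t →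
    HasDerivWithinAt (xc i)
      (K.Ac *ᵥ xc i t + iota C i • (K.Jc *ᵥ xc i t) + K.Bc *ᵥ (K.Fc *ᵥ xc i t)
        + K.Cc *ᵥ zetaBar G C (fun j => x j t) (xr t) i
        + K.Dc *ᵥ zetaHat G (fun j => K.Ec *ᵥ xc j t) i)
      (Set.Ici 0) t

/-- Regulated state synchronization: `x i - xr → 0` for every agent. -/
def RegulatedSync {N n : ℕ} (x : Fin N → ℝ → Fin n → ℝ) (xr : ℝ → Fin n → ℝ) : Prop :=
  ∀ i, Filter.Tendsto (fun t => x i t - xr t) Filter.atTop (nhds 0)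

/-- The saturation is never active: `σ(u i (t)) = u i (t)` for all agents and all `t ≥ 0`. -/
def NeverSaturated {N n m nc : ℕ} (K : LinearProtocol n m nc) (xc : Fin N → ℝ → Fin nc → ℝ) :
    Prop :=
  ∀ i, ∀ t, 0 ≤ t → satVec (K.Fc *ᵥ xc i t) = K.Fc *ᵥ xc i t

/-- Solvability of the scalable semi-global regulated state synchronization problem with
full-state coupling and additional information exchange: there is a linear protocol with parameter
`ε ∈ (0, 1]`, chosen from `(A, B)` only (before the network), that semi-globally achieves regulated
state synchronization. The matrix `Ec` that defines the exchanged variable does not depend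
on `ε`. -/
def SemiGlobalProblemSolvable {n m : ℕ} (A : Matrix (Fin n) (Fin n) ℝ)
    (B : Matrix (Fin n) (Fin m) ℝ) : Prop :=
  ∃ (nc : ℕ) (K : ℝ → LinearProtocol n m nc),
    (∃ Ec : Matrix (Fin n) (Fin nc) ℝ, ∀ ε ∈ Set.Ioc (0 : ℝ) 1, (K ε).Ec = Ec) ∧
    ∀ (Sa Se : Set (Fin n → ℝ)) (Sc : Set (Fin nc → ℝ)),
      IsCompact Sa → IsCompact Se → IsCompact Sc →
      ∀ (N : ℕ) (C : Finset (Fin N)) (G : WeightedGraph N), G.HasRootSet C →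
      ∃ εs ∈ Set.Ioc (0 : ℝ) 1, ∀ ε ∈ Set.Ioc (0 : ℝ) εs,
      ∀ (x₀ : Fin N → Fin n → ℝ) (xr₀ : Fin n → ℝ) (xc₀ : Fin N → Fin nc → ℝ),
        (∀ i, x₀ i ∈ Sa) → xr₀ ∈ Se → (∀ i, xc₀ i ∈ Sc) →
        (∃ x xr xc, IsClosedLoopSolution A B (K ε) G C x₀ xr₀ xc₀ x xr xc) ∧
        ∀ x xr xc, IsClosedLoopSolution A B (K ε) G C x₀ xr₀ xc₀ x xr xc → RegulatedSync x xr

end RegSync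

end

/-! Put `e i = x i - xr - χ i`. While no actuator saturates, the network input `ζBar - ζHat - ι χ`
equals `L e`, with `L` the grounded Laplacian, and the loop becomes a cascade: `e' = A e - L e`, and
`χ' = (A - B Bᵀ P) χ + L e`.

The first equation does not involve `ε`. A maximum-modulus argument along a path from the root puts
the spectrum of `L` in the open right half plane (`eigenvalue_re_pos`). Since `A` and `L` act on
different indices they commute, so every eigenvalue of `A - L` is a difference with negative real
part, and `e` decays exponentially (`exists_error_decay`).

In the second equation `χᵀ P χ` is a Lyapunov function. If `P ≤ p I`, the decaying forcing keeps it
below `p D`, with `D` independent of `ε` (`IsRiccatiSolution.form_le`), and then `|Bᵀ P χ|` is of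
order `p`. As `P → 0` when `ε → 0` (`riccatiSolution_small`), the inputs stay in `[-1, 1]` for small
`ε`. The linear trajectory therefore solves the saturated loop, is its only solution by the
Lipschitz property, and has `x - xr = e + χ → 0`.

For the Riccati equation, Kleinman's iteration gives existence and a Sylvester equation gives
uniqueness. Solutions increase with `ε`, so those with `ε ≤ 1` are bounded. Their cluster points as
`ε → 0` solve the equation without penalty, whose only semidefinite solution is zero
(`riccati_zero_penalty`); this is where the spectrum of `A` and stabilizability meet. -/

namespace RegSync

open Filter Topology Set

/-! ### Linear differential equations: growth bounds from eigenvalues. -/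

/-- A linear vector field on a finite-dimensional space has a global integral curve through every
point. -/
theorem exists_linear_flow {V : Type*} [NormedAddCommGroup V] [NormedSpace ℝ V]
    [FiniteDimensional ℝ V] (T : V →ₗ[ℝ] V) (v : V) :
    ∃ z : ℝ → V, z 0 = v ∧ ∀ t, HasDerivAt z (T (z t)) t := by
  have : CompleteSpace V := FiniteDimensional.complete ℝ V
  let S : V →L[ℝ] V := LinearMap.toContinuousLinearMap T
  refine ⟨fun t => NormedSpace.exp (t • S) v, by simp, fun t => ?_⟩
  exact (hasDerivAt_exp_smul_const' (𝕂 := ℝ) S t).clm_apply (hasDerivAt_const t v) |>.congr_deriv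
    (by simp [S])

section Growth

variable {V : Type*} [NormedAddCommGroup V] [NormedSpace ℂ V]

/-- Growth of a solution of `z' = lam z + y` when `y` is bounded by a faster exponential. -/
theorem norm_le_exp_of_scalar_equation {lam : ℂ} {β C : ℝ} (hβ : lam.re < β) {z y : ℝ → V}
    (hz : ∀ t, HasDerivAt z (lam • z t + y t) t)
    (hy : ∀ t, 0 ≤ t → ‖y t‖ ≤ C * Real.exp (β * t)) {t : ℝ} (ht : 0 ≤ t) :
    ‖z t‖ ≤ (‖z 0‖ + C / (β - lam.re)) * Real.exp (β * t) := by
  have hC : 0 ≤ C := by simpa using (norm_nonneg _).trans (hy 0 le_rfl)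
  have hd : 0 < β - lam.re := sub_pos.2 hβ
  have hexp : ∀ s : ℝ, HasDerivAt (fun s : ℝ => Complex.exp (-lam * s))
      (Complex.exp (-lam * s) * -lam) s := fun s => by
    have h1 : HasDerivAt (fun s : ℝ => -lam * (s : ℂ)) (-lam) s := by
      simpa using (Complex.ofRealCLM.hasDerivAt (x := s)).const_mul (-lam)
    exact h1.cexp
  have hnorm : ∀ s : ℝ, ‖Complex.exp (-lam * s)‖ = Real.exp (-lam.re * s) := fun s => by
    simp [Complex.norm_exp]
  -- Integrating factor: `w' = exp (-lam s) y` has norm at most `C exp ((β - re lam) s)`, which is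
  -- integrable in closed form.
  let w : ℝ → V := fun s => Complex.exp (-lam * s) • z s
  have hw : ∀ s : ℝ, HasDerivAt w (Complex.exp (-lam * s) • y s) s := fun s => by
    refine ((hexp s).smul (hz s)).congr_deriv ?_
    rw [smul_add, mul_neg, neg_smul, smul_smul]
    abel
  have hB : ∀ s, HasDerivAt (fun s => ‖z 0‖ + C / (β - lam.re) * Real.exp ((β - lam.re) * s))
      (C * Real.exp ((β - lam.re) * s)) s := fun s => by
    have h1 : HasDerivAt (fun s => (β - lam.re) * s) (β - lam.re) s := by
      simpa using (hasDerivAt_id s).const_mul (β - lam.re)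
    refine ((h1.exp.const_mul (C / (β - lam.re))).const_add _).congr_deriv ?_
    field_simp
  have key := image_norm_le_of_norm_deriv_right_le_deriv_boundary (f := w) (a := 0) (b := t)
    (fun s _ => (hw s).continuousAt.continuousWithinAt) (fun s _ => (hw s).hasDerivWithinAt)
    (by simp only [w]; simp; positivity) hB
    (fun s hs => by
      rw [norm_smul, hnorm]
      calc Real.exp (-lam.re * s) * ‖y s‖ ≤ Real.exp (-lam.re * s) * (C * Real.exp (β * s)) := by
            gcongr; exact hy s hs.1
        _ = C * Real.exp ((β - lam.re) * s) := by
            rw [mul_left_comm, ← Real.exp_add]; congr 2; ring)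
    (right_mem_Icc.2 ht)
  have hzw : ‖z t‖ = Real.exp (lam.re * t) * ‖w t‖ := by
    simp only [w]
    rw [norm_smul, hnorm, ← mul_assoc, ← Real.exp_add]; simp
  rw [hzw]
  calc Real.exp (lam.re * t) * ‖w t‖
      ≤ Real.exp (lam.re * t) * (‖z 0‖ + C / (β - lam.re) * Real.exp ((β - lam.re) * t)) := by
        gcongr
    _ = ‖z 0‖ * Real.exp (lam.re * t) + C / (β - lam.re) * Real.exp (β * t) := by
        rw [mul_add, mul_left_comm, ← Real.exp_add, mul_comm]; congr 3; ring
    _ ≤ ‖z 0‖ * Real.exp (β * t) + C / (β - lam.re) * Real.exp (β * t) := by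
        gcongr
    _ = _ := by ring

variable [FiniteDimensional ℂ V]

/-- Induction on the linear factors, in place of a Jordan form: `(T - a) z` is again a solution and
is killed by the remaining factors, so it is bounded, and `z' = a z + (T - a) z` is a scalar
equation. The strict inequality `re a < β` absorbs the polynomial factors of repeated roots. -/
theorem growth_of_annihilating_product (T : V →ₗ[ℂ] V) (β : ℝ) (s : Multiset ℂ) :
    (∀ a ∈ s, a.re < β) → ∃ C, 0 ≤ C ∧ ∀ z : ℝ → V, (∀ t, HasDerivAt z (T (z t)) t) →
      (∀ t, Polynomial.aeval T (s.map fun a => Polynomial.X - Polynomial.C a).prod (z t) = 0) →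
      ∀ t, 0 ≤ t → ‖z t‖ ≤ C * ‖z 0‖ * Real.exp (β * t) := by
  induction s using Multiset.induction_on with
  | empty =>
    intro _
    refine ⟨0, le_rfl, fun z _ h t _ => ?_⟩
    have := h t
    simp at this
    simp [this]
  | cons a s ih =>
    intro hs
    obtain ⟨C, hC, h⟩ := ih fun b hb => hs b (Multiset.mem_cons_of_mem hb)
    have ha : a.re < β := hs a (Multiset.mem_cons_self a s)
    have hd : 0 < β - a.re := sub_pos.2 ha
    let S : V →L[ℂ] V := LinearMap.toContinuousLinearMap (T - a • 1)
    have hS : ∀ v, S v = T v - a • v := fun v => by simp [S]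
    refine ⟨1 + C * ‖S‖ / (β - a.re), by positivity, fun z hz hp t ht => ?_⟩
    have hy := h (fun t => S (z t))
      (fun t => by
        have h1 : HasDerivAt (fun t => S (z t)) (S (T (z t))) t :=
          (S.restrictScalars ℝ).hasFDerivAt.comp_hasDerivAt t (hz t)
        refine h1.congr_deriv ?_
        simp [hS])
      (fun t => by
        have := hp t
        rw [Multiset.map_cons, Multiset.prod_cons, mul_comm, map_mul, Module.End.mul_apply] at this
        have h2 : Polynomial.aeval T (Polynomial.X - Polynomial.C a) (z t) = S (z t) := by
          rw [hS]; simp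
        rwa [h2] at this)
    have := norm_le_exp_of_scalar_equation (C := C * ‖S (z 0)‖) ha (z := z) (y := fun t => S (z t))
      (fun t => (hz t).congr_deriv (by simp [hS])) hy ht
    refine this.trans ?_
    gcongr
    have h3 : C * ‖S (z 0)‖ ≤ C * (‖S‖ * ‖z 0‖) := by gcongr; exact S.le_opNorm _
    calc ‖z 0‖ + C * ‖S (z 0)‖ / (β - a.re) ≤ ‖z 0‖ + C * (‖S‖ * ‖z 0‖) / (β - a.re) := by gcongr
      _ = _ := by ring

/-- Solutions of `z' = T z` grow at most like `exp (β t)` when all eigenvalues of `T` have real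
part less than `β`. -/
theorem growth_of_eigenvalues (T : V →ₗ[ℂ] V) (β : ℝ)
    (hT : ∀ (a : ℂ) (v : V), v ≠ 0 → T v = a • v → a.re < β) :
    ∃ C, 0 ≤ C ∧ ∀ z : ℝ → V, (∀ t, HasDerivAt z (T (z t)) t) →
      ∀ t, 0 ≤ t → ‖z t‖ ≤ C * ‖z 0‖ * Real.exp (β * t) := by
  have hint : IsIntegral ℂ T := Algebra.IsIntegral.isIntegral T
  obtain ⟨C, hC, h⟩ := growth_of_annihilating_product T β (minpoly ℂ T).roots (fun a ha => by
    have := Module.End.hasEigenvalue_of_isRoot (Polynomial.isRoot_of_mem_roots ha)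
    obtain ⟨v, hv⟩ := this.exists_hasEigenvector
    exact hT a v hv.2 hv.apply_eq_smul)
  refine ⟨C, hC, fun z hz => h z hz fun t => ?_⟩
  rw [← (IsAlgClosed.splits (minpoly ℂ T)).eq_prod_roots_of_monic (minpoly.monic hint)]
  simp

/-- If all eigenvalues of `T` lie in the open left half plane, the solutions of `z' = T z` decay
exponentially, with uniform rate. -/
theorem exists_decay_of_eigenvalues (T : V →ₗ[ℂ] V)
    (hT : ∀ (a : ℂ) (v : V), v ≠ 0 → T v = a • v → a.re < 0) :
    ∃ C μ, 0 ≤ C ∧ 0 < μ ∧ ∀ z : ℝ → V, (∀ t, HasDerivAt z (T (z t)) t) →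
      ∀ t, 0 ≤ t → ‖z t‖ ≤ C * ‖z 0‖ * Real.exp (-μ * t) := by
  obtain ⟨μ, hμ, h⟩ : ∃ μ : ℝ, 0 < μ ∧ ∀ a : ℂ, Module.End.HasEigenvalue T a → a.re < -μ := by
    have hfin : {a : ℂ | Module.End.HasEigenvalue T a}.Finite := Module.End.finite_hasEigenvalue T
    have hneg : ∀ a ∈ {a : ℂ | Module.End.HasEigenvalue T a}, a.re < 0 := fun a ha => by
      obtain ⟨v, hv⟩ := Module.End.HasEigenvalue.exists_hasEigenvector ha
      exact hT a v hv.2 hv.apply_eq_smul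
    have hev : ∀ᶠ μ in 𝓝[>] (0 : ℝ), ∀ a ∈ {a : ℂ | Module.End.HasEigenvalue T a}, a.re < -μ := by
      rw [Filter.eventually_all_finite hfin]
      intro a ha
      have : Iio (-a.re) ∈ 𝓝 (0 : ℝ) := Iio_mem_nhds (by have := hneg a ha; linarith)
      filter_upwards [mem_nhdsWithin_of_mem_nhds this] with μ hμ
      have : μ < -a.re := hμ
      linarith
    obtain ⟨μ, h1, h2⟩ := (hev.and self_mem_nhdsWithin).exists
    exact ⟨μ, h2, fun a ha => h1 a ha⟩
  obtain ⟨C, hC, hg⟩ := growth_of_eigenvalues T (-μ) fun a v hv hav =>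
    h a (Module.End.hasEigenvalue_of_hasEigenvector
      (x := v) (Module.End.hasEigenvector_iff.2 ⟨Module.End.mem_eigenspace_iff.2 hav, hv⟩))
  exact ⟨C, μ, hC, hμ, hg⟩

/-- A nonzero invariant subspace contains an eigenvector. -/
theorem exists_eigenvector_mem (T : V →ₗ[ℂ] V) (p : Submodule ℂ V) (hp : p ≠ ⊥)
    (hT : ∀ v ∈ p, T v ∈ p) : ∃ (a : ℂ) (v : V), v ∈ p ∧ v ≠ 0 ∧ T v = a • v := by
  have : Nontrivial p := Submodule.nontrivial_iff_ne_bot.2 hp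
  obtain ⟨a, ha⟩ := Module.End.exists_eigenvalue (T.restrict hT)
  obtain ⟨v, hv⟩ := ha.exists_hasEigenvector
  refine ⟨a, v, v.2, fun h => hv.2 (Subtype.ext h), ?_⟩
  simpa using congrArg Subtype.val hv.apply_eq_smul

end Growth

end RegSync

namespace RegSync

open Filter Topology Set

/-! ### Quadratic forms and a scalar comparison lemma. -/

section QuadraticForms

variable {ι κ : Type*} [Fintype ι] [Fintype κ]

theorem hasDerivAt_mulVec (M : Matrix κ ι ℝ) {z : ℝ → ι → ℝ} {z' : ι → ℝ} {t : ℝ}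
    (hz : HasDerivAt z z' t) : HasDerivAt (fun t => M *ᵥ z t) (M *ᵥ z') t :=
  (LinearMap.toContinuousLinearMap (Matrix.mulVecLin M)).hasFDerivAt.comp_hasDerivAt t hz

theorem hasDerivAt_dotProduct_mulVec (X : Matrix κ ι ℝ) {y : ℝ → κ → ℝ} {y' : κ → ℝ}
    {z : ℝ → ι → ℝ} {z' : ι → ℝ} {t : ℝ} (hy : HasDerivAt y y' t) (hz : HasDerivAt z z' t) :
    HasDerivAt (fun t => y t ⬝ᵥ X *ᵥ z t) (y' ⬝ᵥ X *ᵥ z t + y t ⬝ᵥ X *ᵥ z') t := by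
  have h := hasDerivAt_mulVec X hz
  rw [hasDerivAt_pi] at hy h
  have := HasDerivAt.fun_sum (u := Finset.univ) fun i _ => (hy i).mul (h i)
  refine this.congr_deriv ?_
  simp [dotProduct, Finset.sum_add_distrib]

theorem dotProduct_mulVec_symm {P : Matrix ι ι ℝ} (hP : Pᵀ = P) (x y : ι → ℝ) :
    x ⬝ᵥ P *ᵥ y = y ⬝ᵥ P *ᵥ x := by
  rw [Matrix.dotProduct_mulVec, ← Matrix.mulVec_transpose, hP, dotProduct_comm]

/-- Young's inequality for the form of `P`: expand it at `s x - y` and divide by `s`. The weight `s`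
is left free; it is later a constant for convergence and `exp (-μ t)` for bounds uniform in `ε`. -/
theorem two_mul_dotProduct_mulVec_le {P : Matrix ι ι ℝ} (hP : Pᵀ = P)
    (hpos : ∀ v, 0 ≤ v ⬝ᵥ P *ᵥ v) (x y : ι → ℝ) {s : ℝ} (hs : 0 < s) :
    2 * (x ⬝ᵥ P *ᵥ y) ≤ s * (x ⬝ᵥ P *ᵥ x) + s⁻¹ * (y ⬝ᵥ P *ᵥ y) := by
  have h := hpos (s • x - y)
  simp only [Matrix.mulVec_sub, Matrix.mulVec_smul, sub_dotProduct, dotProduct_sub,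
    smul_dotProduct, dotProduct_smul, smul_eq_mul, dotProduct_mulVec_symm hP y x] at h
  have h2 := mul_nonneg (inv_nonneg.2 hs.le) h
  have : s⁻¹ * (s * (s * (x ⬝ᵥ P *ᵥ x)) - s * (x ⬝ᵥ P *ᵥ y) - (s * (x ⬝ᵥ P *ᵥ y) - y ⬝ᵥ P *ᵥ y))
      = s * (x ⬝ᵥ P *ᵥ x) + s⁻¹ * (y ⬝ᵥ P *ᵥ y) - 2 * (x ⬝ᵥ P *ᵥ y) := by
    field_simp; ring
  linarith

/-- The Cauchy-Schwarz inequality for a positive semidefinite form. -/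
theorem sq_dotProduct_mulVec_le {P : Matrix ι ι ℝ} (hP : Pᵀ = P)
    (hpos : ∀ v, 0 ≤ v ⬝ᵥ P *ᵥ v) (x y : ι → ℝ) :
    (x ⬝ᵥ P *ᵥ y) ^ 2 ≤ (x ⬝ᵥ P *ᵥ x) * (y ⬝ᵥ P *ᵥ y) := by
  have h : ∀ s : ℝ, 0 ≤ (x ⬝ᵥ P *ᵥ x) * (s * s) + (-2 * (x ⬝ᵥ P *ᵥ y)) * s + y ⬝ᵥ P *ᵥ y := by
    intro s
    have h := hpos (s • x - y)
    simp only [Matrix.mulVec_sub, Matrix.mulVec_smul, sub_dotProduct, dotProduct_sub,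
      smul_dotProduct, dotProduct_smul, smul_eq_mul, dotProduct_mulVec_symm hP y x] at h
    linarith
  have := discrim_le_zero h
  rw [discrim] at this
  linarith

theorem sq_le_dotProduct_self (x : ι → ℝ) (i : ι) : x i ^ 2 ≤ x ⬝ᵥ x := by
  rw [sq, dotProduct]
  exact Finset.single_le_sum (f := fun i => x i * x i) (fun j _ => mul_self_nonneg _)
    (Finset.mem_univ i)

theorem dotProduct_self_nonneg_real (x : ι → ℝ) : 0 ≤ x ⬝ᵥ x :=
  Finset.sum_nonneg fun _ _ => mul_self_nonneg _

theorem dotProduct_mulVec_le_sum_abs (P : Matrix ι ι ℝ) (x : ι → ℝ) :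
    x ⬝ᵥ P *ᵥ x ≤ (∑ i, ∑ j, |P i j|) * (x ⬝ᵥ x) := by
  have : x ⬝ᵥ P *ᵥ x = ∑ i, ∑ j, P i j * (x i * x j) := by
    simp only [dotProduct, Matrix.mulVec, Finset.mul_sum]
    exact Finset.sum_congr rfl fun i _ => Finset.sum_congr rfl fun j _ => by ring
  rw [this, Finset.sum_mul]
  refine Finset.sum_le_sum fun i _ => ?_
  rw [Finset.sum_mul]
  refine Finset.sum_le_sum fun j _ => ?_
  refine (le_abs_self _).trans ?_
  rw [abs_mul]
  gcongr
  have h1 := sq_le_dotProduct_self x i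
  have h2 := sq_le_dotProduct_self x j
  rw [abs_le]
  constructor <;> nlinarith [sq_nonneg (x i + x j), sq_nonneg (x i - x j)]

theorem matrix_eq_zero_of_dotProduct_mulVec [DecidableEq ι] [DecidableEq κ] {X : Matrix κ ι ℝ}
    (h : ∀ v w, v ⬝ᵥ X *ᵥ w = 0) : X = 0 := by
  ext i j
  simpa using h (Pi.single i 1) (Pi.single j 1)

theorem posDef_transpose {ι : Type*} {P : Matrix ι ι ℝ} (hP : P.PosDef) : Pᵀ = P := by
  simpa [Matrix.conjTranspose_eq_transpose_of_trivial] using hP.isHermitian.eq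

theorem posDef_dotProduct_nonneg {P : Matrix ι ι ℝ} (hP : P.PosDef) (v : ι → ℝ) :
    0 ≤ v ⬝ᵥ P *ᵥ v := by
  simpa using hP.posSemidef.dotProduct_mulVec_nonneg v

theorem posDef_of_dotProduct {P : Matrix ι ι ℝ} (hP : Pᵀ = P)
    (h : ∀ v, v ≠ 0 → 0 < v ⬝ᵥ P *ᵥ v) : P.PosDef :=
  Matrix.PosDef.of_dotProduct_mulVec_pos
    (by rw [Matrix.IsHermitian, Matrix.conjTranspose_eq_transpose_of_trivial, hP])
    fun v hv => by simpa using h v hv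

/-- A positive definite form controls the Euclidean square norm. -/
theorem exists_dotProduct_self_le [DecidableEq ι] {P : Matrix ι ι ℝ} (hP : P.PosDef) :
    ∃ c, ∀ x : ι → ℝ, x ⬝ᵥ x ≤ c * (x ⬝ᵥ P *ᵥ x) := by
  have hs := posDef_transpose hP
  -- `w k` represents the `k`-th coordinate in the inner product of `P`, so Cauchy-Schwarz bounds
  -- each `x k ^ 2`.
  let w : ι → ι → ℝ := fun k => P⁻¹ *ᵥ Pi.single k 1
  refine ⟨∑ k, w k ⬝ᵥ P *ᵥ w k, fun x => ?_⟩
  rw [Finset.sum_mul, dotProduct]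
  refine Finset.sum_le_sum fun k _ => ?_
  have hk : x k = w k ⬝ᵥ P *ᵥ x := by
    rw [dotProduct_mulVec_symm hs, Matrix.mulVec_mulVec,
      Matrix.mul_nonsing_inv _ ((Matrix.isUnit_iff_isUnit_det _).1 hP.isUnit), Matrix.one_mulVec]
    simp
  calc x k * x k = (w k ⬝ᵥ P *ᵥ x) ^ 2 := by rw [← hk, sq]
    _ ≤ _ := sq_dotProduct_mulVec_le hs (posDef_dotProduct_nonneg hP) _ _

theorem tendsto_zero_of_dotProduct_self {α : Type*} {l : Filter α} {z : α → ι → ℝ}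
    (h : Tendsto (fun t => z t ⬝ᵥ z t) l (𝓝 0)) : Tendsto z l (𝓝 0) := by
  rw [tendsto_pi_nhds]
  intro i
  have h1 : Tendsto (fun t => z t i ^ 2) l (𝓝 0) :=
    squeeze_zero (fun t => sq_nonneg _) (fun t => sq_le_dotProduct_self (z t) i) h
  have h2 := (Real.continuous_sqrt.tendsto 0).comp h1
  refine (tendsto_zero_iff_abs_tendsto_zero _).2 ?_
  simpa [Function.comp_def, Real.sqrt_sq_eq_abs] using h2

end QuadraticForms

/-- The function `W`, which is `exp (a t) V` plus a multiple of `exp (-(ν - a) t)`, is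
nonincreasing, whence `V = O(exp (-a t))`. The gap `a < ν` avoids resonance with the forcing. -/
theorem tendsto_zero_of_deriv_le {V V' : ℝ → ℝ} {a b ν : ℝ} (ha : 0 < a) (hν : a < ν)
    (hV : ∀ t, HasDerivAt V (V' t) t) (hnn : ∀ t, 0 ≤ V t)
    (hle : ∀ t, 0 ≤ t → V' t ≤ -a * V t + b * Real.exp (-ν * t)) :
    Tendsto V atTop (𝓝 0) := by
  have hd : 0 < ν - a := sub_pos.2 hν
  have hexp : ∀ c t : ℝ, HasDerivAt (fun t => Real.exp (c * t)) (Real.exp (c * t) * c) t :=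
    fun c t => by
      have h1 : HasDerivAt (fun s => c * s) c t := by simpa using (hasDerivAt_id t).const_mul c
      exact h1.exp
  let W : ℝ → ℝ := fun t => V t * Real.exp (a * t) + b / (ν - a) * Real.exp (-(ν - a) * t)
  have hW : ∀ t, HasDerivAt W (V' t * Real.exp (a * t) + V t * (Real.exp (a * t) * a)
      + b / (ν - a) * (Real.exp (-(ν - a) * t) * -(ν - a))) t := fun t =>
    ((hV t).mul (hexp a t)).add ((hexp _ t).const_mul _)
  have hanti : AntitoneOn W (Ici 0) := by
    refine antitoneOn_of_deriv_nonpos (convex_Ici 0)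
      (fun t _ => (hW t).continuousAt.continuousWithinAt)
      (fun t _ => (hW t).differentiableAt.differentiableWithinAt) fun t ht => ?_
    rw [interior_Ici] at ht
    rw [(hW t).deriv]
    have h1 := mul_le_mul_of_nonneg_right (hle t (le_of_lt ht)) (Real.exp_pos (a * t)).le
    have h2 : Real.exp (-ν * t) * Real.exp (a * t) = Real.exp (-(ν - a) * t) := by
      rw [← Real.exp_add]; ring_nf
    have h3 : b / (ν - a) * (Real.exp (-(ν - a) * t) * -(ν - a))
        = - (b * Real.exp (-(ν - a) * t)) := by field_simp
    rw [h3]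
    rw [add_mul, mul_assoc b, h2] at h1
    linarith
  have hbound : ∀ t, 0 ≤ t → V t ≤ (W 0 + |b / (ν - a)|) * Real.exp (-a * t) := fun t ht => by
    have h1 : W t ≤ W 0 := hanti self_mem_Ici ht ht
    have h2 : -|b / (ν - a)| ≤ b / (ν - a) * Real.exp (-(ν - a) * t) := by
      have h3 : Real.exp (-(ν - a) * t) ≤ 1 := Real.exp_le_one_iff.2 (by nlinarith)
      have h4 := neg_abs_le (b / (ν - a) * Real.exp (-(ν - a) * t))
      rw [abs_mul, abs_of_pos (Real.exp_pos _)] at h4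
      nlinarith [abs_nonneg (b / (ν - a))]
    have h5 : V t * Real.exp (a * t) ≤ W 0 + |b / (ν - a)| := by
      simp only [W] at h1 ⊢; linarith
    calc V t = V t * Real.exp (a * t) * Real.exp (-a * t) := by
          rw [mul_assoc, ← Real.exp_add]; simp
      _ ≤ _ := by gcongr
  have hlim : Tendsto (fun t => (W 0 + |b / (ν - a)|) * Real.exp (-a * t)) atTop (𝓝 0) := by
    have : Tendsto (fun t : ℝ => Real.exp (-a * t)) atTop (𝓝 0) :=
      Real.tendsto_exp_atBot.comp (tendsto_id.const_mul_atTop_of_neg (neg_lt_zero.2 ha))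
    simpa using this.const_mul (W 0 + |b / (ν - a)|)
  exact squeeze_zero' (Eventually.of_forall hnn)
    ((eventually_ge_atTop 0).mono fun t ht => hbound t ht) hlim

/-! ### Stability, Lyapunov functions, and the Lyapunov and Sylvester equations. -/

section Stability

variable {ι κ : Type*} [Fintype ι] [Fintype κ]

/-- Every solution of `z' = A z` tends to zero. -/
def IsAsymptoticallyStable (A : Matrix ι ι ℝ) : Prop :=
  ∀ z : ℝ → ι → ℝ, (∀ t, HasDerivAt z (A *ᵥ z t) t) → Tendsto z atTop (𝓝 0)

theorem exists_matrix_flow (A : Matrix ι ι ℝ) (v : ι → ℝ) :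
    ∃ z : ℝ → ι → ℝ, z 0 = v ∧ ∀ t, HasDerivAt z (A *ᵥ z t) t :=
  exists_linear_flow (Matrix.mulVecLin A) v

theorem mem_spectrum_of_mulVec_eq_smul [DecidableEq ι] {M : Matrix ι ι ℂ} {a : ℂ} {v : ι → ℂ} (hv : v ≠ 0)
    (h : M *ᵥ v = a • v) : a ∈ spectrum ℂ M := by
  rw [← Matrix.spectrum_toLin']
  refine Module.End.HasEigenvalue.mem_spectrum
    (Module.End.hasEigenvalue_of_hasEigenvector (x := v) ?_)
  exact Module.End.hasEigenvector_iff.2 ⟨Module.End.mem_eigenspace_iff.2 (by simpa using h), hv⟩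

theorem mulVec_map_ofReal {κ : Type*} (A : Matrix κ ι ℝ) (v : ι → ℝ) :
    A.map Complex.ofReal *ᵥ (fun i => (v i : ℂ)) = fun i => ((A *ᵥ v) i : ℂ) := by
  ext i
  simp [Matrix.mulVec, dotProduct]

theorem IsHurwitz.isAsymptoticallyStable {n : ℕ} {A : Matrix (Fin n) (Fin n) ℝ}
    (hA : IsHurwitz A) : IsAsymptoticallyStable A := by
  obtain ⟨C, μ, hC, hμ, h⟩ := exists_decay_of_eigenvalues
    (Matrix.toLin' (A.map Complex.ofReal)) fun a v hv hav =>
      hA a (mem_spectrum_of_mulVec_eq_smul hv (by simpa using hav))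
  intro z hz
  let w : ℝ → Fin n → ℂ := fun t i => (z t i : ℂ)
  have hw : ∀ t, HasDerivAt w (Matrix.toLin' (A.map Complex.ofReal) (w t)) t := fun t => by
    rw [Matrix.toLin'_apply, mulVec_map_ofReal, hasDerivAt_pi]
    intro i
    exact ((hasDerivAt_pi.1 (hz t)) i).ofReal_comp
  have hlim : Tendsto (fun t => C * ‖w 0‖ * Real.exp (-μ * t)) atTop (𝓝 0) := by
    have : Tendsto (fun t : ℝ => Real.exp (-μ * t)) atTop (𝓝 0) :=
      Real.tendsto_exp_atBot.comp (tendsto_id.const_mul_atTop_of_neg (neg_lt_zero.2 hμ))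
    simpa using this.const_mul (C * ‖w 0‖)
  rw [tendsto_pi_nhds]
  intro i
  refine squeeze_zero_norm' ((eventually_ge_atTop 0).mono fun t ht => ?_) hlim
  refine le_trans ?_ (h w hw t ht)
  simpa [w] using norm_le_pi_norm (w t) i

/-- A Lyapunov function forces convergence, also under an exponentially decaying input. -/
theorem tendsto_zero_of_lyapunov [DecidableEq ι] {F P : Matrix ι ι ℝ} (hP : P.PosDef) {q : ℝ} (hq : 0 < q)
    (hF : ∀ v, 2 * (v ⬝ᵥ P *ᵥ (F *ᵥ v)) ≤ -q * (v ⬝ᵥ v)) {G μ : ℝ} (hμ : 0 < μ)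
    {z g : ℝ → ι → ℝ} (hz : ∀ t, HasDerivAt z (F *ᵥ z t + g t) t)
    (hg : ∀ t, 0 ≤ t → g t ⬝ᵥ g t ≤ G * Real.exp (-μ * t)) :
    Tendsto z atTop (𝓝 0) := by
  have hs := posDef_transpose hP
  have hnn := posDef_dotProduct_nonneg hP
  obtain ⟨p, hp, hle⟩ : ∃ p, 0 < p ∧ ∀ v, v ⬝ᵥ P *ᵥ v ≤ p * (v ⬝ᵥ v) := by
    have h0 : (0 : ℝ) ≤ ∑ i, ∑ j, |P i j| :=
      Finset.sum_nonneg fun i _ => Finset.sum_nonneg fun j _ => abs_nonneg _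
    refine ⟨(∑ i, ∑ j, |P i j|) + 1, by positivity, fun v => ?_⟩
    have := dotProduct_mulVec_le_sum_abs P v
    have := dotProduct_self_nonneg_real v
    linarith
  -- Since `zᵀ P z ≤ p |z|²`, the decay term is at most `-2 s zᵀ P z`. Young's inequality with
  -- weight `s` spends half of it on the input. The rate is then capped at `μ / 2` to stay below
  -- that of the forcing.
  let s := q / (2 * p)
  have hs0 : 0 < s := by positivity
  have hVlim : Tendsto (fun t => z t ⬝ᵥ P *ᵥ z t) atTop (𝓝 0) := by
    refine tendsto_zero_of_deriv_le (a := min s (μ / 2)) (b := s⁻¹ * (p * G)) (ν := μ)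
      (lt_min hs0 (by linarith)) (by linarith [min_le_right s (μ / 2)])
      (fun t => hasDerivAt_dotProduct_mulVec P (hz t) (hz t)) (fun t => hnn _) fun t ht => ?_
    have h1 := two_mul_dotProduct_mulVec_le hs hnn (z t) (g t) hs0
    have h2 := hF (z t)
    have h3 := hle (z t)
    have h4 : g t ⬝ᵥ P *ᵥ g t ≤ p * (G * Real.exp (-μ * t)) :=
      (hle _).trans (mul_le_mul_of_nonneg_left (hg t ht) hp.le)
    have h5 : s⁻¹ * (g t ⬝ᵥ P *ᵥ g t) ≤ s⁻¹ * (p * (G * Real.exp (-μ * t))) :=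
      mul_le_mul_of_nonneg_left h4 (inv_nonneg.2 hs0.le)
    have h6 : 2 * s * (z t ⬝ᵥ P *ᵥ z t) ≤ q * (z t ⬝ᵥ z t) := by
      calc 2 * s * (z t ⬝ᵥ P *ᵥ z t) ≤ 2 * s * (p * (z t ⬝ᵥ z t)) := by gcongr
        _ = _ := by simp only [s]; field_simp
    have h7 : min s (μ / 2) * (z t ⬝ᵥ P *ᵥ z t) ≤ s * (z t ⬝ᵥ P *ᵥ z t) :=
      mul_le_mul_of_nonneg_right (min_le_left _ _) (hnn _)
    rw [dotProduct_mulVec_symm hs (F *ᵥ z t + g t), Matrix.mulVec_add, dotProduct_add]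
    have h8 : s⁻¹ * (p * G) * Real.exp (-μ * t) = s⁻¹ * (p * (G * Real.exp (-μ * t))) := by ring
    rw [h8]
    linarith
  obtain ⟨c, hc⟩ := exists_dotProduct_self_le hP
  refine tendsto_zero_of_dotProduct_self
    (squeeze_zero (fun t => dotProduct_self_nonneg_real _) (fun t => hc (z t)) ?_)
  simpa using hVlim.const_mul c

theorem isAsymptoticallyStable_of_lyapunov [DecidableEq ι] {F P : Matrix ι ι ℝ} (hP : P.PosDef) {q : ℝ}
    (hq : 0 < q) (hF : ∀ v, 2 * (v ⬝ᵥ P *ᵥ (F *ᵥ v)) ≤ -q * (v ⬝ᵥ v)) :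
    IsAsymptoticallyStable F := fun z hz =>
  tendsto_zero_of_lyapunov hP hq hF one_pos (g := fun _ => 0) (G := 0)
    (fun t => by simpa using hz t) (by simp)

theorem dotProduct_mulVec_sylvester (A₁ : Matrix κ κ ℝ) (A₂ : Matrix ι ι ℝ) (X : Matrix κ ι ℝ)
    (y : κ → ℝ) (z : ι → ℝ) :
    (A₁ *ᵥ y) ⬝ᵥ X *ᵥ z + y ⬝ᵥ X *ᵥ (A₂ *ᵥ z) = y ⬝ᵥ (A₁ᵀ * X + X * A₂) *ᵥ z := by
  rw [Matrix.add_mulVec, dotProduct_add, Matrix.mulVec_mulVec, ← Matrix.mulVec_mulVec z A₁ᵀ,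
    Matrix.dotProduct_mulVec y A₁ᵀ, Matrix.vecMul_transpose]

theorem tendsto_dotProduct_mulVec_zero (X : Matrix κ ι ℝ) {α : Type*} {l : Filter α}
    {y : α → κ → ℝ} {z : α → ι → ℝ} (hy : Tendsto y l (𝓝 0)) (hz : Tendsto z l (𝓝 0)) :
    Tendsto (fun t => y t ⬝ᵥ X *ᵥ z t) l (𝓝 0) := by
  have hc : Continuous fun q : (κ → ℝ) × (ι → ℝ) => q.1 ⬝ᵥ X *ᵥ q.2 := by fun_prop
  have h1 := (hc.tendsto (0, 0)).comp (hy.prodMk_nhds hz)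
  simpa [Function.comp_def] using h1

/-- The homogeneous Sylvester equation of two stable matrices has only the trivial solution. -/
theorem sylvester_eq_zero [DecidableEq ι] [DecidableEq κ] {A₁ : Matrix κ κ ℝ} {A₂ : Matrix ι ι ℝ} (h₁ : IsAsymptoticallyStable A₁)
    (h₂ : IsAsymptoticallyStable A₂) {X : Matrix κ ι ℝ} (hX : A₁ᵀ * X + X * A₂ = 0) : X = 0 := by
  refine matrix_eq_zero_of_dotProduct_mulVec fun v w => ?_
  obtain ⟨y, rfl, hy⟩ := exists_matrix_flow A₁ v
  obtain ⟨z, rfl, hz⟩ := exists_matrix_flow A₂ w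
  -- The equation for `X` says that `yᵀ X z` is constant along the two flows; stability makes its
  -- limit zero.
  have hd : ∀ t, HasDerivAt (fun t => y t ⬝ᵥ X *ᵥ z t) 0 t := fun t => by
    have := hasDerivAt_dotProduct_mulVec X (hy t) (hz t)
    rwa [dotProduct_mulVec_sylvester, hX, Matrix.zero_mulVec, dotProduct_zero] at this
  have hconst : ∀ t, y t ⬝ᵥ X *ᵥ z t = y 0 ⬝ᵥ X *ᵥ z 0 := fun t =>
    is_const_of_deriv_eq_zero (fun t => (hd t).differentiableAt) (fun t => (hd t).deriv) t 0
  have hlim := tendsto_dotProduct_mulVec_zero X (h₁ y hy) (h₂ z hz)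
  simp only [hconst] at hlim
  exact tendsto_const_nhds_iff.1 hlim

/-- Along the flow of `A` the form of `X` is nonincreasing with limit zero, so it starts
nonnegative. This is the comparison principle behind every ordering of Riccati solutions and
iterates below. -/
theorem lyapunov_nonneg {A X : Matrix ι ι ℝ} (hA : IsAsymptoticallyStable A)
    (hX : ∀ v, v ⬝ᵥ (Aᵀ * X + X * A) *ᵥ v ≤ 0) (v : ι → ℝ) : 0 ≤ v ⬝ᵥ X *ᵥ v := by
  obtain ⟨z, rfl, hz⟩ := exists_matrix_flow A v
  have hd : ∀ t, HasDerivAt (fun t => z t ⬝ᵥ X *ᵥ z t) (z t ⬝ᵥ (Aᵀ * X + X * A) *ᵥ z t) t :=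
    fun t => by
      have := hasDerivAt_dotProduct_mulVec X (hz t) (hz t)
      rwa [dotProduct_mulVec_sylvester] at this
  have hanti : Antitone fun t => z t ⬝ᵥ X *ᵥ z t :=
    antitone_of_deriv_nonpos (fun t => (hd t).differentiableAt)
      fun t => by rw [(hd t).deriv]; exact hX _
  exact hanti.le_of_tendsto (tendsto_dotProduct_mulVec_zero X (hA z hz) (hA z hz)) 0

/-- The Lyapunov equation of a stable matrix is solvable. -/
theorem exists_lyapunov_solution [DecidableEq ι] {A : Matrix ι ι ℝ} (hA : IsAsymptoticallyStable A)
    {Q : Matrix ι ι ℝ} (hQ : Qᵀ = Q) : ∃ X : Matrix ι ι ℝ, Xᵀ = X ∧ Aᵀ * X + X * A = Q := by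
  let L : Matrix ι ι ℝ →ₗ[ℝ] Matrix ι ι ℝ :=
    LinearMap.mulLeft ℝ Aᵀ + LinearMap.mulRight ℝ A
  have hL : ∀ X, L X = Aᵀ * X + X * A := fun X => by simp [L]
  -- Injectivity gives surjectivity in finite dimension, and symmetry of `X` too, because `Xᵀ`
  -- solves the same equation.
  have hinj : Function.Injective L := (injective_iff_map_eq_zero L).2 fun X hX =>
    sylvester_eq_zero hA hA (by rw [← hL, hX])
  obtain ⟨X, hX⟩ := (LinearMap.injective_iff_surjective.1 hinj) Q
  refine ⟨X, hinj ?_, by rw [← hL, hX]⟩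
  rw [hX, hL, ← hQ, ← hX, hL, Matrix.transpose_add, Matrix.transpose_mul, Matrix.transpose_mul,
    Matrix.transpose_transpose, add_comm]

end Stability

end RegSync

namespace RegSync

open Filter Topology Set

/-! ### The Riccati equation: existence, uniqueness, and the limit of small `ε`. -/

section Riccati

variable {ι κ : Type*} [Fintype ι] [Fintype κ]

theorem dotProduct_transpose_mul_self (M : Matrix κ ι ℝ) (v : ι → ℝ) :
    v ⬝ᵥ (Mᵀ * M) *ᵥ v = (M *ᵥ v) ⬝ᵥ (M *ᵥ v) := by
  rw [← Matrix.mulVec_mulVec, Matrix.dotProduct_mulVec, Matrix.vecMul_transpose]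

theorem dotProduct_transpose_mul_self_nonneg (M : Matrix κ ι ℝ) (v : ι → ℝ) :
    0 ≤ v ⬝ᵥ (Mᵀ * M) *ᵥ v := by
  rw [dotProduct_transpose_mul_self]; exact dotProduct_self_nonneg_real _

theorem two_mul_dotProduct_mulVec_mulVec {P F : Matrix ι ι ℝ} (hP : Pᵀ = P) (v : ι → ℝ) :
    2 * (v ⬝ᵥ P *ᵥ (F *ᵥ v)) = v ⬝ᵥ (Fᵀ * P + P * F) *ᵥ v := by
  rw [← dotProduct_mulVec_sylvester, dotProduct_mulVec_symm hP (F *ᵥ v), two_mul]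

/-- Cauchy-Schwarz applied to `P v` and `v` gives `|P v|⁴ ≤ 0`. -/
theorem mulVec_eq_zero_of_dotProduct_mulVec_eq_zero {P : Matrix ι ι ℝ} (hP : Pᵀ = P)
    (hpos : ∀ v, 0 ≤ v ⬝ᵥ P *ᵥ v) {v : ι → ℝ} (hv : v ⬝ᵥ P *ᵥ v = 0) : P *ᵥ v = 0 := by
  have h := sq_dotProduct_mulVec_le hP hpos (P *ᵥ v) v
  rw [hv, mul_zero] at h
  have h2 := pow_eq_zero_iff (two_ne_zero) |>.1 (le_antisymm h (sq_nonneg _))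
  exact dotProduct_self_eq_zero.1 h2

/-- A null vector `v` of the form has `P v = 0`, so the Lyapunov expression vanishes at `v`, yet it
is at most `-q |v|²`. -/
theorem posDef_of_lyapunov {P F : Matrix ι ι ℝ} (hP : Pᵀ = P) (hpos : ∀ v, 0 ≤ v ⬝ᵥ P *ᵥ v)
    {q : ℝ} (hq : 0 < q) (hF : ∀ v, v ⬝ᵥ (Fᵀ * P + P * F) *ᵥ v ≤ -q * (v ⬝ᵥ v)) : P.PosDef := by
  refine posDef_of_dotProduct hP fun v hv => lt_of_le_of_ne (hpos v) fun h0 => hv ?_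
  have h1 := mulVec_eq_zero_of_dotProduct_mulVec_eq_zero hP hpos h0.symm
  have h2 := hF v
  rw [← two_mul_dotProduct_mulVec_mulVec hP, dotProduct_mulVec_symm hP, h1, dotProduct_zero] at h2
  have h3 := dotProduct_self_nonneg_real v
  exact dotProduct_self_eq_zero.1 (by nlinarith)

/-- Each value of the form is decreasing and bounded below; polarization recovers the matrix entries
from these values. -/
theorem exists_tendsto_of_antitone_forms [DecidableEq ι] {P : ℕ → Matrix ι ι ℝ}
    (hs : ∀ k, (P k)ᵀ = P k) (hpos : ∀ k v, 0 ≤ v ⬝ᵥ P k *ᵥ v)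
    (hanti : ∀ v, Antitone fun k => v ⬝ᵥ P k *ᵥ v) : ∃ L, Tendsto P atTop (𝓝 L) := by
  have hlim : ∀ v, ∃ l, Tendsto (fun k => v ⬝ᵥ P k *ᵥ v) atTop (𝓝 l) := fun v =>
    ⟨_, tendsto_atTop_ciInf (hanti v) ⟨0, by rintro _ ⟨k, rfl⟩; exact hpos k v⟩⟩
  choose l hl using hlim
  let e : ι → ι → ℝ := fun i => Pi.single i 1
  refine ⟨fun i j => (l (e i + e j) - l (e i) - l (e j)) / 2, ?_⟩
  refine tendsto_pi_nhds.2 fun i => tendsto_pi_nhds.2 fun j => ?_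
  have h := (((hl (e i + e j)).sub (hl (e i))).sub (hl (e j))).div_const 2
  refine h.congr fun k => ?_
  have h1 : e i ⬝ᵥ P k *ᵥ e j = P k i j := by simp [e]
  have h2 : e j ⬝ᵥ P k *ᵥ e i = P k i j := by rw [dotProduct_mulVec_symm (hs k), h1]
  rw [Matrix.mulVec_add, add_dotProduct, dotProduct_add, dotProduct_add, h1, h2]
  ring

end Riccati

section RiccatiEquation

variable {n m : ℕ} {A : Matrix (Fin n) (Fin n) ℝ} {B : Matrix (Fin n) (Fin m) ℝ}

/-- Moving the quadratic term into the closed-loop matrix turns the Riccati equation into a Lyapunov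
equation, so that `P` itself certifies the stability of `A - B Bᵀ P`. -/
theorem riccati_closed_loop_lyapunov {ε : ℝ} {P : Matrix (Fin n) (Fin n) ℝ} (hs : Pᵀ = P)
    (h : Aᵀ * P + P * A - P * B * Bᵀ * P + ε • (1 : Matrix (Fin n) (Fin n) ℝ) = 0) :
    (A - B * (Bᵀ * P))ᵀ * P + P * (A - B * (Bᵀ * P))
      = -(ε • (1 : Matrix (Fin n) (Fin n) ℝ)) - (Bᵀ * P)ᵀ * (Bᵀ * P) := by
  linear_combination (norm := skip) h
  simp only [Matrix.transpose_sub, Matrix.transpose_mul, Matrix.transpose_transpose, hs,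
    Matrix.mul_sub, Matrix.sub_mul, Matrix.mul_assoc]
  abel

theorem dotProduct_closed_loop_le {ε : ℝ} {M : Matrix (Fin n) (Fin n) ℝ}
    (K : Matrix (Fin m) (Fin n) ℝ)
    (h : M = -(ε • (1 : Matrix (Fin n) (Fin n) ℝ)) - Kᵀ * K) (v : Fin n → ℝ) :
    v ⬝ᵥ M *ᵥ v ≤ -ε * (v ⬝ᵥ v) := by
  have := dotProduct_transpose_mul_self_nonneg K v
  rw [h, Matrix.sub_mulVec, Matrix.neg_mulVec, Matrix.smul_mulVec, Matrix.one_mulVec,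
    dotProduct_sub, dotProduct_neg, dotProduct_smul, smul_eq_mul]
  linarith

theorem IsRiccatiSolution.closed_loop_le {ε : ℝ} {P : Matrix (Fin n) (Fin n) ℝ}
    (h : IsRiccatiSolution A B ε P) (v : Fin n → ℝ) :
    2 * (v ⬝ᵥ P *ᵥ ((A - B * (Bᵀ * P)) *ᵥ v)) ≤ -ε * (v ⬝ᵥ v) := by
  have hs := posDef_transpose h.1
  rw [two_mul_dotProduct_mulVec_mulVec hs]
  exact dotProduct_closed_loop_le _ (riccati_closed_loop_lyapunov hs h.2) v

theorem IsRiccatiSolution.isAsymptoticallyStable {ε : ℝ} (hε : 0 < ε)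
    {P : Matrix (Fin n) (Fin n) ℝ} (h : IsRiccatiSolution A B ε P) :
    IsAsymptoticallyStable (A - B * (Bᵀ * P)) :=
  isAsymptoticallyStable_of_lyapunov h.1 hε h.closed_loop_le

/-- Subtracting the equations gives a homogeneous Sylvester equation for `P - Q`, with the closed
loop of `P` on the left and that of `Q` on the right, both stable. -/
theorem IsRiccatiSolution.unique {ε : ℝ} (hε : 0 < ε) {P Q : Matrix (Fin n) (Fin n) ℝ}
    (hP : IsRiccatiSolution A B ε P) (hQ : IsRiccatiSolution A B ε Q) : P = Q := by
  rw [← sub_eq_zero]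
  refine sylvester_eq_zero (hP.isAsymptoticallyStable hε) (hQ.isAsymptoticallyStable hε) ?_
  linear_combination (norm := skip) hP.2 - hQ.2
  simp only [Matrix.transpose_sub, Matrix.transpose_mul, Matrix.transpose_transpose,
    posDef_transpose hP.1, Matrix.mul_sub, Matrix.sub_mul, Matrix.mul_assoc]
  abel

/-- Completing the square, `Q - P` solves a Lyapunov equation for the closed loop of `Q` with a
negative semidefinite right-hand side. -/
theorem IsRiccatiSolution.mono {ε₁ ε₂ : ℝ} (hε : ε₁ ≤ ε₂) (h₂ : 0 < ε₂)
    {P Q : Matrix (Fin n) (Fin n) ℝ} (hP : IsRiccatiSolution A B ε₁ P)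
    (hQ : IsRiccatiSolution A B ε₂ Q) (v : Fin n → ℝ) : v ⬝ᵥ P *ᵥ v ≤ v ⬝ᵥ Q *ᵥ v := by
  have key : (A - B * (Bᵀ * Q))ᵀ * (Q - P) + (Q - P) * (A - B * (Bᵀ * Q))
      = -((ε₂ - ε₁) • (1 : Matrix (Fin n) (Fin n) ℝ)) - (Bᵀ * (Q - P))ᵀ * (Bᵀ * (Q - P)) := by
    linear_combination (norm := skip) hQ.2 - hP.2
    simp only [Matrix.transpose_sub, Matrix.transpose_mul, Matrix.transpose_transpose, sub_smul,
      posDef_transpose hP.1, posDef_transpose hQ.1, Matrix.mul_sub, Matrix.sub_mul,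
      Matrix.mul_assoc]
    abel
  have := lyapunov_nonneg (hQ.isAsymptoticallyStable h₂) (X := Q - P) (fun v =>
    (dotProduct_closed_loop_le _ key v).trans (by
      have := dotProduct_self_nonneg_real v
      nlinarith)) v
  rw [Matrix.sub_mulVec, dotProduct_sub] at this
  linarith

/-- One step of Kleinman's iteration. -/
theorem exists_kleinman_step {ε : ℝ} (hε : 0 < ε) {K : Matrix (Fin m) (Fin n) ℝ}
    (hK : IsAsymptoticallyStable (A - B * K)) :
    ∃ P : Matrix (Fin n) (Fin n) ℝ, P.PosDef ∧
      (A - B * K)ᵀ * P + P * (A - B * K) = -(ε • (1 : Matrix (Fin n) (Fin n) ℝ)) - Kᵀ * K ∧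
      IsAsymptoticallyStable (A - B * (Bᵀ * P)) := by
  obtain ⟨P, hs, hP⟩ := exists_lyapunov_solution hK
    (Q := -(ε • (1 : Matrix (Fin n) (Fin n) ℝ)) - Kᵀ * K) (by
      simp [Matrix.transpose_sub, Matrix.transpose_mul])
  have hle := dotProduct_closed_loop_le K hP
  have hnn := lyapunov_nonneg hK fun v => (hle v).trans (by
    have := dotProduct_self_nonneg_real v
    nlinarith)
  have hpd := posDef_of_lyapunov hs hnn hε hle
  refine ⟨P, hpd, hP, isAsymptoticallyStable_of_lyapunov hpd hε fun v => ?_⟩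
  rw [two_mul_dotProduct_mulVec_mulVec hs]
  -- Replacing the gain `K` by `Bᵀ P` completes a square, so the same `P` is a Lyapunov function of
  -- the updated loop.
  have key : (A - B * (Bᵀ * P))ᵀ * P + P * (A - B * (Bᵀ * P))
      = (-(ε • (1 : Matrix (Fin n) (Fin n) ℝ)) - (Bᵀ * P)ᵀ * (Bᵀ * P))
        - (K - Bᵀ * P)ᵀ * (K - Bᵀ * P) := by
    linear_combination (norm := skip) hP
    simp only [Matrix.transpose_sub, Matrix.transpose_mul, Matrix.transpose_transpose, hs,
      Matrix.mul_sub, Matrix.sub_mul, Matrix.mul_assoc]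
    abel
  rw [key, Matrix.sub_mulVec, dotProduct_sub]
  have h1 := dotProduct_closed_loop_le (Bᵀ * P) rfl v (ε := ε)
  have h2 := dotProduct_transpose_mul_self_nonneg (K - Bᵀ * P) v
  linarith

/-- For the updated loop, the Lyapunov expression of `P - Q` is minus the square of the change of
gain, so `P - Q` is semidefinite. -/
theorem kleinman_step_antitone {ε : ℝ} {K : Matrix (Fin m) (Fin n) ℝ}
    {P Q : Matrix (Fin n) (Fin n) ℝ} (hs : Pᵀ = P)
    (hP : (A - B * K)ᵀ * P + P * (A - B * K)
      = -(ε • (1 : Matrix (Fin n) (Fin n) ℝ)) - Kᵀ * K)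
    (hst : IsAsymptoticallyStable (A - B * (Bᵀ * P)))
    (hQ : (A - B * (Bᵀ * P))ᵀ * Q + Q * (A - B * (Bᵀ * P))
      = -(ε • (1 : Matrix (Fin n) (Fin n) ℝ)) - (Bᵀ * P)ᵀ * (Bᵀ * P)) (v : Fin n → ℝ) :
    v ⬝ᵥ Q *ᵥ v ≤ v ⬝ᵥ P *ᵥ v := by
  have key : (A - B * (Bᵀ * P))ᵀ * (P - Q) + (P - Q) * (A - B * (Bᵀ * P))
      = -((K - Bᵀ * P)ᵀ * (K - Bᵀ * P)) := by
    linear_combination (norm := skip) hP - hQ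
    simp only [Matrix.transpose_sub, Matrix.transpose_mul, Matrix.transpose_transpose, hs,
      Matrix.mul_sub, Matrix.sub_mul, Matrix.mul_assoc]
    abel
  have := lyapunov_nonneg hst (X := P - Q) (fun v => by
    rw [key, Matrix.neg_mulVec, dotProduct_neg]
    exact neg_nonpos.2 (dotProduct_transpose_mul_self_nonneg _ v)) v
  rw [Matrix.sub_mulVec, dotProduct_sub] at this
  linarith

/-- The algebraic Riccati equation of a stabilizable pair has a positive definite solution. -/
theorem exists_riccatiSolution (hAB : IsStabilizable A B) {ε : ℝ} (hε : 0 < ε) :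
    ∃ P, IsRiccatiSolution A B ε P := by
  obtain ⟨F, hF⟩ := hAB
  have h0 : IsAsymptoticallyStable (A - B * (-F)) := by
    simpa [Matrix.mul_neg] using hF.isAsymptoticallyStable
  have step := fun K : {K : Matrix (Fin m) (Fin n) ℝ // IsAsymptoticallyStable (A - B * K)} =>
    exists_kleinman_step (A := A) (B := B) hε K.2
  choose p hpd hp hst using step
  -- The gains carry their stability proofs. The iteration starts at `-F` because the loop is
  -- written `A - B K`.
  let s : ℕ → {K : Matrix (Fin m) (Fin n) ℝ // IsAsymptoticallyStable (A - B * K)} := fun k =>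
    Nat.rec ⟨-F, h0⟩ (fun _ K => ⟨Bᵀ * p K, hst K⟩) k
  let P : ℕ → Matrix (Fin n) (Fin n) ℝ := fun k => p (s k)
  have hs : ∀ k, (P k)ᵀ = P k := fun k => posDef_transpose (hpd _)
  have hnn : ∀ k v, 0 ≤ v ⬝ᵥ P k *ᵥ v := fun k => posDef_dotProduct_nonneg (hpd _)
  have hnext : ∀ k, (A - B * (Bᵀ * P k))ᵀ * P (k + 1) + P (k + 1) * (A - B * (Bᵀ * P k))
      = -(ε • (1 : Matrix (Fin n) (Fin n) ℝ)) - (Bᵀ * P k)ᵀ * (Bᵀ * P k) := fun k =>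
    hp (s (k + 1))
  obtain ⟨L, hL⟩ := exists_tendsto_of_antitone_forms hs hnn fun v =>
    antitone_nat_of_succ_le fun k =>
      kleinman_step_antitone (hs k) (hp (s k)) (hst (s k)) (hnext k) v
  have hLs : Lᵀ = L := by
    have hc : Continuous fun X : Matrix (Fin n) (Fin n) ℝ => Xᵀ := by fun_prop
    exact tendsto_nhds_unique (((hc.tendsto L).comp hL).congr hs) hL
  have hLnn : ∀ v, 0 ≤ v ⬝ᵥ L *ᵥ v := fun v => by
    have hc : Continuous fun X : Matrix (Fin n) (Fin n) ℝ => v ⬝ᵥ X *ᵥ v := by fun_prop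
    exact ge_of_tendsto' ((hc.tendsto L).comp hL) fun k => hnn k v
  -- `P k` and `P (k + 1)` have the same limit, so the recursion becomes a fixed-point equation,
  -- which is the Riccati equation.
  have hLeq : (A - B * (Bᵀ * L))ᵀ * L + L * (A - B * (Bᵀ * L))
      = -(ε • (1 : Matrix (Fin n) (Fin n) ℝ)) - (Bᵀ * L)ᵀ * (Bᵀ * L) := by
    have hc₁ : Continuous fun X : Matrix (Fin n) (Fin n) ℝ × Matrix (Fin n) (Fin n) ℝ =>
        (A - B * (Bᵀ * X.1))ᵀ * X.2 + X.2 * (A - B * (Bᵀ * X.1)) := by fun_prop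
    have hc₂ : Continuous fun X : Matrix (Fin n) (Fin n) ℝ =>
        -(ε • (1 : Matrix (Fin n) (Fin n) ℝ)) - (Bᵀ * X)ᵀ * (Bᵀ * X) := by fun_prop
    have h1 := (hc₁.tendsto (L, L)).comp (hL.prodMk_nhds (hL.comp (tendsto_add_atTop_nat 1)))
    exact tendsto_nhds_unique (h1.congr hnext) ((hc₂.tendsto L).comp hL)
  refine ⟨L, posDef_of_lyapunov hLs hLnn hε (dotProduct_closed_loop_le _ hLeq), ?_⟩
  linear_combination (norm := skip) hLeq
  simp only [Matrix.transpose_sub, Matrix.transpose_mul, Matrix.transpose_transpose, hLs,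
    Matrix.mul_sub, Matrix.sub_mul, Matrix.mul_assoc]
  abel

theorem mem_spectrum_of_transpose_mulVec_eq_smul {M : Matrix (Fin n) (Fin n) ℂ} {a : ℂ}
    {v : Fin n → ℂ} (hv : v ≠ 0) (h : Mᵀ *ᵥ v = a • v) : a ∈ spectrum ℂ M := by
  have h1 := mem_spectrum_of_mulVec_eq_smul hv h
  rw [spectrum.mem_iff] at h1 ⊢
  refine fun h2 => h1 ?_
  rw [← Matrix.isUnit_transpose] at h2
  simpa [Algebra.algebraMap_eq_smul_one] using h2

theorem re_mulVec_map_ofReal (M : Matrix (Fin m) (Fin n) ℝ) (v : Fin n → ℂ) (i : Fin m) :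
    ((M.map Complex.ofReal *ᵥ v) i).re = (M *ᵥ fun j => (v j).re) i := by
  simp [Matrix.mulVec, dotProduct]

theorem im_mulVec_map_ofReal (M : Matrix (Fin m) (Fin n) ℝ) (v : Fin n → ℂ) (i : Fin m) :
    ((M.map Complex.ofReal *ᵥ v) i).im = (M *ᵥ fun j => (v j).im) i := by
  simp [Matrix.mulVec, dotProduct]

/-- Without a state penalty, the only positive semidefinite solution of the Riccati equation is
zero, provided `A` has no eigenvalues in the open right half plane. -/
theorem riccati_zero_penalty (hA : IsAtMostWeaklyUnstable A) (hAB : IsStabilizable A B)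
    {X : Matrix (Fin n) (Fin n) ℝ} (hs : Xᵀ = X) (hnn : ∀ v, 0 ≤ v ⬝ᵥ X *ᵥ v)
    (hX : Aᵀ * X + X * A - X * B * Bᵀ * X = 0) : X = 0 := by
  by_contra hne
  let c : ∀ {k l : ℕ}, Matrix (Fin k) (Fin l) ℝ → Matrix (Fin k) (Fin l) ℂ :=
    fun M => M.map Complex.ofReal
  have hcmul : ∀ {k l r : ℕ} (M : Matrix (Fin k) (Fin l) ℝ) (M' : Matrix (Fin l) (Fin r) ℝ),
      c (M * M') = c M * c M' := fun M M' => by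
    ext i j; simp [c, Matrix.mul_apply]
  -- The range of `X` is thus invariant under `Aᵀ`, and if nonzero it contains an eigenvector `X v`
  -- of `Aᵀ`.
  have hXA : Aᵀ * X = X * (B * Bᵀ * X - A) := by
    linear_combination (norm := skip) hX
    simp only [Matrix.mul_sub, Matrix.mul_assoc]
    abel
  obtain ⟨a, w, ⟨v, rfl⟩, hw0, hw⟩ := exists_eigenvector_mem (Matrix.toLin' (c A)ᵀ)
    (LinearMap.range (Matrix.toLin' (c X))) (fun h => hne (by
      rw [LinearMap.range_eq_bot, LinearEquiv.map_eq_zero_iff] at h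
      ext i j
      simpa [c] using congrFun (congrFun h i) j)) (by
      rintro _ ⟨u, rfl⟩
      refine ⟨c (B * Bᵀ * X - A) *ᵥ u, ?_⟩
      have : (c A)ᵀ * c X = c X * c (B * Bᵀ * X - A) := by rw [← hcmul, ← hXA, hcmul]; rfl
      simp only [Matrix.toLin'_apply, Matrix.mulVec_mulVec, this])
  simp only [Matrix.toLin'_apply] at hw hw0
  let x : Fin n → ℝ := fun i => (v i).re
  let y : Fin n → ℝ := fun i => (v i).im
  have hre : ∀ i, ((c X *ᵥ v) i).re = (X *ᵥ x) i := re_mulVec_map_ofReal X v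
  have him : ∀ i, ((c X *ᵥ v) i).im = (X *ᵥ y) i := im_mulVec_map_ofReal X v
  have h1 : Aᵀ *ᵥ (X *ᵥ x) = a.re • (X *ᵥ x) - a.im • (X *ᵥ y) := by
    ext i
    have := congrArg Complex.re (congrFun hw i)
    rw [show (c A)ᵀ = c Aᵀ from rfl, re_mulVec_map_ofReal] at this
    simpa [hre, him] using this
  have h2 : Aᵀ *ᵥ (X *ᵥ y) = a.re • (X *ᵥ y) + a.im • (X *ᵥ x) := by
    ext i
    have := congrArg Complex.im (congrFun hw i)
    rw [show (c A)ᵀ = c Aᵀ from rfl, im_mulVec_map_ofReal] at this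
    simpa [hre, him] using this
  have hform : ∀ u : Fin n → ℝ, 2 * (u ⬝ᵥ Aᵀ *ᵥ (X *ᵥ u))
      = ((Bᵀ * X) *ᵥ u) ⬝ᵥ ((Bᵀ * X) *ᵥ u) := fun u => by
    have h3 : Aᵀ * X + X * A = (Bᵀ * X)ᵀ * (Bᵀ * X) := by
      linear_combination (norm := skip) hX
      simp only [Matrix.transpose_mul, Matrix.transpose_transpose, hs, Matrix.mul_assoc]
      abel
    rw [← dotProduct_transpose_mul_self, ← h3, ← two_mul_dotProduct_mulVec_mulVec hs,
      dotProduct_mulVec_symm hs, Matrix.dotProduct_mulVec u, Matrix.vecMul_transpose]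
  -- The real form of `2 re(a) v* X v = |Bᵀ X v|²`. The left side is nonpositive, so both sides
  -- vanish and `Bᵀ X v = 0`.
  have hsum : 2 * a.re * (x ⬝ᵥ X *ᵥ x + y ⬝ᵥ X *ᵥ y)
      = ((Bᵀ * X) *ᵥ x) ⬝ᵥ ((Bᵀ * X) *ᵥ x) + ((Bᵀ * X) *ᵥ y) ⬝ᵥ ((Bᵀ * X) *ᵥ y) := by
    rw [← hform, ← hform, h1, h2]
    simp only [dotProduct_sub, dotProduct_add, dotProduct_smul, smul_eq_mul]
    rw [dotProduct_mulVec_symm hs y x]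
    ring
  have ha : a.re ≤ 0 := hA a (mem_spectrum_of_transpose_mulVec_eq_smul hw0 hw)
  have hq := add_nonneg (hnn x) (hnn y)
  have hb1 := dotProduct_self_nonneg_real ((Bᵀ * X) *ᵥ x)
  have hb2 := dotProduct_self_nonneg_real ((Bᵀ * X) *ᵥ y)
  have hle : 2 * a.re * (x ⬝ᵥ X *ᵥ x + y ⬝ᵥ X *ᵥ y) ≤ 0 :=
    mul_nonpos_of_nonpos_of_nonneg (by linarith) hq
  have hBx : (Bᵀ * X) *ᵥ x = 0 := dotProduct_self_eq_zero.1 (by linarith)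
  have hBy : (Bᵀ * X) *ᵥ y = 0 := dotProduct_self_eq_zero.1 (by linarith)
  have hBw : c Bᵀ *ᵥ (c X *ᵥ v) = 0 := by
    rw [Matrix.mulVec_mulVec, ← hcmul]
    ext i
    refine Complex.ext ?_ ?_
    · exact (re_mulVec_map_ofReal _ v i).trans (congrFun hBx i)
    · exact (im_mulVec_map_ofReal _ v i).trans (congrFun hBy i)
  -- As `Bᵀ X v = 0`, feedback does not move this eigenvalue: `X v` is also an eigenvector of `(A +
  -- B F)ᵀ`. Hence `re a < 0`, which forces `v* X v = 0` and then `X v = 0`.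
  obtain ⟨F, hF⟩ := hAB
  have hneg : a.re < 0 := hF a (mem_spectrum_of_transpose_mulVec_eq_smul hw0 (by
    have : ((A + B * F).map Complex.ofReal)ᵀ = (c A)ᵀ + c Fᵀ * c Bᵀ := by
      rw [← hcmul, ← Matrix.transpose_mul]
      ext i j; simp [c, -Matrix.transpose_mul]
    rw [this, Matrix.add_mulVec, ← Matrix.mulVec_mulVec, hBw, Matrix.mulVec_zero, add_zero, hw]))
  have hq0 : x ⬝ᵥ X *ᵥ x + y ⬝ᵥ X *ᵥ y = 0 := by
    have h5 : 2 * a.re * (x ⬝ᵥ X *ᵥ x + y ⬝ᵥ X *ᵥ y) = 0 := by linarith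
    exact (mul_eq_zero.1 h5).resolve_left (by linarith)
  have hXx := mulVec_eq_zero_of_dotProduct_mulVec_eq_zero hs hnn
    (v := x) (by linarith [hnn x, hnn y])
  have hXy := mulVec_eq_zero_of_dotProduct_mulVec_eq_zero hs hnn
    (v := y) (by linarith [hnn x, hnn y])
  refine hw0 (funext fun i => Complex.ext ?_ ?_)
  · rw [hre, hXx]; rfl
  · rw [him, hXy]; rfl

/-- The solutions of the Riccati equation tend to zero with the parameter. -/
theorem riccatiSolution_small (hA : IsAtMostWeaklyUnstable A) (hAB : IsStabilizable A B)
    {δ : ℝ} (hδ : 0 < δ) : ∃ εs ∈ Ioc (0 : ℝ) 1, ∀ ε ∈ Ioc (0 : ℝ) εs, ∀ P,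
      IsRiccatiSolution A B ε P → ∀ v, v ⬝ᵥ P *ᵥ v ≤ δ * (v ⬝ᵥ v) := by
  have hex : ∀ ε : ℝ, ∃ P, 0 < ε → IsRiccatiSolution A B ε P := fun ε => by
    by_cases h : 0 < ε
    · obtain ⟨P, hP⟩ := exists_riccatiSolution hAB h
      exact ⟨P, fun _ => hP⟩
    · exact ⟨0, fun h' => absurd h' h⟩
  choose f hf using hex
  have hev : ∀ᶠ ε in 𝓝[>] (0 : ℝ), ε ∈ Ioc (0 : ℝ) 1 := Ioc_mem_nhdsGT one_pos
  -- For `ε ≤ 1` monotonicity gives `f ε ≤ f 1`, which bounds the diagonal; Cauchy-Schwarz then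
  -- bounds the other entries.
  let K : ℝ := ∑ i, ∑ j, |f 1 i j|
  have hK : 0 ≤ K := Finset.sum_nonneg fun i _ => Finset.sum_nonneg fun j _ => abs_nonneg _
  let S : Set (Matrix (Fin n) (Fin n) ℝ) := Set.pi univ fun _ => Set.pi univ fun _ => Icc (-K) K
  have hS : IsCompact S := isCompact_univ_pi fun _ => isCompact_univ_pi fun _ => isCompact_Icc
  have hmem : ∀ᶠ ε in 𝓝[>] (0 : ℝ), f ε ∈ S := hev.mono fun ε hε i _ j _ => by
    have hε' := hf ε hε.1
    have hdiag : ∀ k, f ε k k ≤ K := fun k => by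
      have h1 := hε'.mono hε.2 one_pos (hf 1 one_pos) (Pi.single k 1)
      have h2 := dotProduct_mulVec_le_sum_abs (f 1) (Pi.single k 1)
      simpa [K] using h1.trans h2
    have hdiag0 : ∀ k, 0 ≤ f ε k k := fun k => by
      simpa using posDef_dotProduct_nonneg hε'.1 (Pi.single k 1)
    have h3 := sq_dotProduct_mulVec_le (posDef_transpose hε'.1) (posDef_dotProduct_nonneg hε'.1)
      (Pi.single i 1) (Pi.single j 1)
    simp only [Matrix.mulVec_single_one, single_one_dotProduct, Matrix.col_apply] at h3
    exact abs_le.1 (abs_le_of_sq_le_sq (h3.trans (by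
      rw [sq]; exact mul_le_mul (hdiag i) (hdiag j) (hdiag0 j) hK)) hK)
  have hlim : Tendsto f (𝓝[>] 0) (𝓝 0) := by
    -- In a compact box it suffices that every cluster point is zero. Along an ultrafilter the
    -- symmetry, the sign and the equation pass to the limit, where the penalty is gone.
    refine hS.tendsto_nhds_of_unique_mapClusterPt hmem fun X _ hX => ?_
    obtain ⟨U, hU, hXU⟩ := mapClusterPt_iff_ultrafilter.1 hX
    have hevU : ∀ᶠ ε in (U : Filter ℝ), 0 < ε := hU (hev.mono fun ε h => h.1)
    have hid : Tendsto (fun ε : ℝ => ε) U (𝓝 0) := tendsto_id.mono_left (hU.trans nhdsWithin_le_nhds)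
    refine riccati_zero_penalty hA hAB ?_ (fun v => ?_) ?_
    · have hc : Continuous fun X : Matrix (Fin n) (Fin n) ℝ => Xᵀ := by fun_prop
      refine tendsto_nhds_unique (((hc.tendsto X).comp hXU).congr' ?_) hXU
      exact hevU.mono fun ε hε => posDef_transpose (hf ε hε).1
    · have hc : Continuous fun X : Matrix (Fin n) (Fin n) ℝ => v ⬝ᵥ X *ᵥ v := by fun_prop
      exact ge_of_tendsto ((hc.tendsto X).comp hXU)
        (hevU.mono fun ε hε => posDef_dotProduct_nonneg (hf ε hε).1 v)
    · have hc : Continuous fun q : ℝ × Matrix (Fin n) (Fin n) ℝ =>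
          Aᵀ * q.2 + q.2 * A - q.2 * B * Bᵀ * q.2 + q.1 • (1 : Matrix (Fin n) (Fin n) ℝ) := by
        fun_prop
      have h1 := (hc.tendsto (0, X)).comp (hid.prodMk_nhds hXU)
      have h2 := tendsto_nhds_unique (h1.congr' (hevU.mono fun ε hε => (hf ε hε).2))
        tendsto_const_nhds
      simpa using h2
  have hsum : Tendsto (fun ε => ∑ i, ∑ j, |f ε i j|) (𝓝[>] 0) (𝓝 0) := by
    have hc : Continuous fun X : Matrix (Fin n) (Fin n) ℝ => ∑ i, ∑ j, |X i j| := by fun_prop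
    simpa [Function.comp_def] using (hc.tendsto 0).comp hlim
  have hsmall : ∀ᶠ ε in 𝓝[>] (0 : ℝ), ε ∈ Ioc (0 : ℝ) 1 ∧ ∑ i, ∑ j, |f ε i j| < δ :=
    hev.and (hsum.eventually (gt_mem_nhds hδ))
  obtain ⟨εs, hεs, hlt⟩ := hsmall.exists
  refine ⟨εs, hεs, fun ε hε P hP v => ?_⟩
  calc v ⬝ᵥ P *ᵥ v ≤ v ⬝ᵥ f εs *ᵥ v := hP.mono hε.2 hεs.1 (hf εs hεs.1) v
    _ ≤ _ := dotProduct_mulVec_le_sum_abs _ v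
    _ ≤ δ * (v ⬝ᵥ v) := mul_le_mul_of_nonneg_right hlt.le (dotProduct_self_nonneg_real v)

end RiccatiEquation

end RegSync

namespace RegSync

open Filter Topology Set

/-! ### The grounded Laplacian and the decay of the observer errors. -/

section Network

variable {N n : ℕ}

/-- The grounded Laplacian of a graph with a root set has its eigenvalues in the open right half
plane. -/
theorem WeightedGraph.HasRootSet.eigenvalue_re_pos {G : WeightedGraph N} {C : Finset (Fin N)}
    (hG : G.HasRootSet C) {b : ℂ} {v : Fin N → ℂ} (hv : v ≠ 0)
    (h : ∀ i, ∑ j, (G.a i j : ℂ) * (v i - v j) + (iota C i : ℂ) * v i = b * v i) : 0 < b.re := by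
  by_contra! hb
  obtain ⟨k, hk⟩ := Function.ne_iff.1 hv
  have : Nonempty (Fin N) := ⟨k⟩
  obtain ⟨i₀, hmax⟩ := Finite.exists_max fun i => ‖v i‖
  have hpos : 0 < ‖v i₀‖ := (norm_pos_iff.2 hk).trans_le (hmax k)
  have hι : ∀ i, 0 ≤ iota C i := fun i => by unfold iota; split_ifs <;> norm_num
  -- With `re b ≤ 0`, the eigenvalue equation at a node of maximal modulus gives `(d + ι) ‖v i‖ ≤ ∑
  -- a ‖v j‖ ≤ d ‖v i‖`. Equality must hold, so the node is not pinned and its in-neighbours are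
  -- also maximal.
  have key : ∀ i, ‖v i‖ = ‖v i₀‖ →
      iota C i = 0 ∧ ∀ j, G.Edge j i → ‖v j‖ = ‖v i₀‖ := by
    intro i hi
    let d : ℝ := ∑ j, G.a i j
    have hd : 0 ≤ d := Finset.sum_nonneg fun j _ => G.nonneg i j
    have h1 : ((d + iota C i : ℝ) - b) * v i = ∑ j, (G.a i j : ℂ) * v j := by
      have h2 := h i
      simp only [mul_sub, Finset.sum_sub_distrib, ← Finset.sum_mul] at h2
      simp only [d]
      push_cast
      linear_combination h2
    have h2 : (d + iota C i) * ‖v i₀‖ ≤ ∑ j, G.a i j * ‖v j‖ := by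
      calc (d + iota C i) * ‖v i₀‖ ≤ ‖((d + iota C i : ℝ) : ℂ) - b‖ * ‖v i‖ := by
            rw [hi]
            gcongr
            refine le_trans ?_ (Complex.re_le_norm _)
            simp only [Complex.sub_re, Complex.ofReal_re]
            linarith
        _ = ‖∑ j, (G.a i j : ℂ) * v j‖ := by rw [← norm_mul, h1]
        _ ≤ ∑ j, ‖(G.a i j : ℂ) * v j‖ := norm_sum_le _ _
        _ = _ := Finset.sum_congr rfl fun j _ => by
            rw [norm_mul, Complex.norm_real, Real.norm_of_nonneg (G.nonneg i j)]
    have h3 : iota C i * ‖v i₀‖ + ∑ j, G.a i j * (‖v i₀‖ - ‖v j‖) ≤ 0 := by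
      simp only [mul_sub, Finset.sum_sub_distrib, ← Finset.sum_mul]
      simp only [d] at h2
      linarith
    have h4 : ∀ j ∈ Finset.univ, 0 ≤ G.a i j * (‖v i₀‖ - ‖v j‖) := fun j _ =>
      mul_nonneg (G.nonneg i j) (sub_nonneg.2 (hmax j))
    have h5 := Finset.sum_nonneg h4
    have h6 := mul_nonneg (hι i) hpos.le
    refine ⟨(mul_eq_zero.1 (by linarith : iota C i * ‖v i₀‖ = 0)).resolve_right hpos.ne',
      fun j hj => ?_⟩
    have h7 := (Finset.sum_eq_zero_iff_of_nonneg h4).1 (by linarith) j (Finset.mem_univ j)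
    have h8 : G.a i j ≠ 0 := ne_of_gt hj
    linarith [(mul_eq_zero.1 h7).resolve_left h8]
  obtain ⟨S, T, r, hr, hi, htree⟩ := hG i₀
  -- Maximality travels backwards along the tree to its root, which lies in `C` and is therefore
  -- pinned.
  have hall : ∀ r, Relation.ReflTransGen T r i₀ → ‖v r‖ = ‖v i₀‖ := fun r hpath => by
    induction hpath using Relation.ReflTransGen.head_induction_on with
    | refl => rfl
    | head hab _ ih => exact (key _ ih).2 _ (htree.edge _ _ hab).2.2
  have := (key r (hall r (htree.path i₀ hi))).1
  simp [iota, hr] at this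

theorem zetaBar_zero_apply (G : WeightedGraph N) (C : Finset (Fin N)) (e : Fin N → Fin n → ℝ)
    (i : Fin N) (k : Fin n) :
    zetaBar G C e 0 i k = ∑ j, G.a i j * (e i k - e j k) + iota C i * e i k := by
  simp [zetaBar]

/-- The observer errors `e' = A e - L e`, with `L` the grounded Laplacian, decay exponentially. -/
theorem exists_error_decay {A : Matrix (Fin n) (Fin n) ℝ} (hA : IsAtMostWeaklyUnstable A)
    {G : WeightedGraph N} {C : Finset (Fin N)} (hG : G.HasRootSet C) :
    ∃ c μ, 0 ≤ c ∧ 0 < μ ∧ ∀ e : ℝ → Fin N → Fin n → ℝ,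
      (∀ t, HasDerivAt e (fun i => A *ᵥ e t i - zetaBar G C (e t) 0 i) t) →
      ∀ t, 0 ≤ t → ‖e t‖ ≤ c * ‖e 0‖ * Real.exp (-μ * t) := by
  let Ac : Matrix (Fin n) (Fin n) ℂ := A.map Complex.ofReal
  let U : (Fin N → Fin n → ℂ) →ₗ[ℂ] (Fin N → Fin n → ℂ) :=
    LinearMap.pi fun i => Matrix.toLin' Ac ∘ₗ LinearMap.proj i
  let L : (Fin N → Fin n → ℂ) →ₗ[ℂ] (Fin N → Fin n → ℂ) :=
    let π : Fin N → (Fin N → Fin n → ℂ) →ₗ[ℂ] (Fin n → ℂ) := LinearMap.proj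
    LinearMap.pi fun i => ∑ j, (G.a i j : ℂ) • (π i - π j) + (iota C i : ℂ) • π i
  have hU : ∀ v i, U v i = Ac *ᵥ v i := fun v i => by simp [U]
  have hL : ∀ v i, L v i = ∑ j, (G.a i j : ℂ) • (v i - v j) + (iota C i : ℂ) • v i :=
    fun v i => by simp [L]
  have hUL : ∀ v, U (L v) = L (U v) := fun v => by
    ext1 i
    simp only [hU, hL, Matrix.mulVec_add, Matrix.mulVec_smul, Matrix.mulVec_sum, Matrix.mulVec_sub]
  obtain ⟨c, μ, hc, hμ, h⟩ := exists_decay_of_eigenvalues (U - L) (by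
    intro a v hv hav
    -- `U` commutes with `L` and so preserves this eigenspace; `w` is a common eigenvector, with
    -- eigenvalue `b` of `U` and `b - a` of `L`. Thus `re a = re b - re (b - a) < 0`.
    obtain ⟨b, w, hw, hw0, hbw⟩ := exists_eigenvector_mem U (LinearMap.ker (U - L - a • 1))
      (fun hbot => hv (by
        have : v ∈ LinearMap.ker (U - L - a • 1) := by simp [← hav]
        simpa [hbot] using this))
      (fun w hw => by
        have hw' : U w - L w = a • w := by simpa [sub_eq_zero] using hw
        have : U (U w) - L (U w) = a • U w := by rw [← hUL, ← map_sub, hw', map_smul]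
        simpa [sub_eq_zero] using this)
    have hLw : L w = (b - a) • w := by
      have hw' : U w - L w = a • w := by simpa [sub_eq_zero] using hw
      rw [sub_smul, ← hbw, ← hw']; abel
    obtain ⟨i, hi⟩ := Function.ne_iff.1 hw0
    obtain ⟨k, hk⟩ := Function.ne_iff.1 hi
    have h1 : b.re ≤ 0 := hA b (mem_spectrum_of_mulVec_eq_smul hi (by
      have := congrFun hbw i
      rwa [hU] at this))
    have h2 : 0 < (b - a).re := hG.eigenvalue_re_pos (v := fun j => w j k)
      (fun h0 => hk (congrFun h0 i)) fun j => by
        have := congrFun (congrFun hLw j) k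
        rw [hL] at this
        simpa using this
    rw [Complex.sub_re] at h2
    linarith)
  refine ⟨c, μ, hc, hμ, fun e he t ht => ?_⟩
  let w : ℝ → Fin N → Fin n → ℂ := fun t i k => (e t i k : ℂ)
  have hnorm : ∀ t, ‖w t‖ = ‖e t‖ := fun t => by simp [w, Pi.norm_def, Pi.nnnorm_def]
  have hw : ∀ t, HasDerivAt w ((U - L) (w t)) t := fun t => by
    rw [hasDerivAt_pi]
    intro i
    rw [hasDerivAt_pi]
    intro k
    have h1 := ((hasDerivAt_pi.1 ((hasDerivAt_pi.1 (he t)) i)) k).ofReal_comp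
    refine h1.congr_deriv ?_
    rw [LinearMap.sub_apply, Pi.sub_apply, Pi.sub_apply, hU, hL, mulVec_map_ofReal, Pi.sub_apply,
      zetaBar_zero_apply]
    simp [w]
  simpa [hnorm] using h w hw t ht

end Network

/-! ### Bounds on the low-gain feedback that are uniform in `ε`. -/

section LowGain

variable {n m : ℕ} {A : Matrix (Fin n) (Fin n) ℝ} {B : Matrix (Fin n) (Fin m) ℝ}

/-- The Lyapunov function of the low-gain feedback stays of the order of the gain under an
exponentially decaying input, uniformly in the parameter. -/
theorem IsRiccatiSolution.form_le {ε : ℝ} (hε : 0 < ε) {P : Matrix (Fin n) (Fin n) ℝ}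
    (hP : IsRiccatiSolution A B ε P) {p Γ μ : ℝ} (hp : 0 < p) (hμ : 0 < μ)
    (hle : ∀ v, v ⬝ᵥ P *ᵥ v ≤ p * (v ⬝ᵥ v)) {z g : ℝ → Fin n → ℝ}
    (hz : ∀ t, HasDerivAt z ((A - B * (Bᵀ * P)) *ᵥ z t + g t) t)
    (hg : ∀ t, 0 ≤ t → g t ⬝ᵥ g t ≤ Γ * Real.exp (-(2 * μ) * t)) {t : ℝ} (ht : 0 ≤ t) :
    z t ⬝ᵥ P *ᵥ z t ≤ p * (z 0 ⬝ᵥ z 0 + Γ) * Real.exp (1 / μ) := by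
  have hs := posDef_transpose hP.1
  have hnn := posDef_dotProduct_nonneg hP.1
  have hΓ : 0 ≤ Γ := by simpa using (dotProduct_self_nonneg_real _).trans (hg 0 le_rfl)
  let V : ℝ → ℝ := fun t => z t ⬝ᵥ P *ᵥ z t
  -- Young's inequality with weight `exp (-μ t)` splits the `exp (-2 μ t)` forcing evenly. The
  -- resulting growth rate is integrable and free of `ε`; the decay term `-ε |z|²` is simply
  -- dropped.
  obtain ⟨V', hV, hV'⟩ : ∃ V' : ℝ → ℝ, (∀ t, HasDerivAt V (V' t) t) ∧
      ∀ t, 0 ≤ t → V' t ≤ Real.exp (-μ * t) * (V t + p * Γ) := by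
    refine ⟨_, fun t => hasDerivAt_dotProduct_mulVec P (hz t) (hz t), fun t ht => ?_⟩
    have h1 := two_mul_dotProduct_mulVec_le hs hnn (z t) (g t) (Real.exp_pos (-μ * t))
    have h2 := hP.closed_loop_le (z t)
    have h3 : g t ⬝ᵥ P *ᵥ g t ≤ p * (Γ * Real.exp (-(2 * μ) * t)) :=
      (hle _).trans (mul_le_mul_of_nonneg_left (hg t ht) hp.le)
    have h4 : (Real.exp (-μ * t))⁻¹ * (g t ⬝ᵥ P *ᵥ g t)
        ≤ (Real.exp (-μ * t))⁻¹ * (p * (Γ * Real.exp (-(2 * μ) * t))) := by gcongr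
    have h5 : (Real.exp (-μ * t))⁻¹ * (p * (Γ * Real.exp (-(2 * μ) * t)))
        = Real.exp (-μ * t) * (p * Γ) := by
      have : Real.exp (-(2 * μ) * t) = Real.exp (-μ * t) * Real.exp (-μ * t) := by
        rw [← Real.exp_add]; ring_nf
      rw [this]; field_simp
    have h6 := mul_nonneg hε.le (dotProduct_self_nonneg_real (z t))
    rw [dotProduct_mulVec_symm hs ((A - B * (Bᵀ * P)) *ᵥ z t + g t), Matrix.mulVec_add,
      dotProduct_add, mul_add]
    simp only [V]
    linarith
  -- The integrating factor for the growth rate `exp (-μ t)`; it lies between `1` and `exp (1 / μ)`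
  -- for `t ≥ 0`.
  let E : ℝ → ℝ := fun t => Real.exp (Real.exp (-μ * t) / μ)
  have hE : ∀ t, HasDerivAt E (E t * -Real.exp (-μ * t)) t := fun t => by
    have h1 : HasDerivAt (fun t => -μ * t) (-μ) t := by simpa using (hasDerivAt_id t).const_mul (-μ)
    refine (h1.exp.div_const μ).exp.congr_deriv ?_
    simp only [E]; field_simp
  have hH : ∀ t, HasDerivAt (fun t => (V t + p * Γ) * E t)
      (V' t * E t + (V t + p * Γ) * (E t * -Real.exp (-μ * t))) t := fun t =>
    ((hV t).add_const _).mul (hE t)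
  have hanti : AntitoneOn (fun t => (V t + p * Γ) * E t) (Ici 0) := by
    refine antitoneOn_of_deriv_nonpos (convex_Ici 0)
      (fun t _ => (hH t).continuousAt.continuousWithinAt)
      (fun t _ => (hH t).differentiableAt.differentiableWithinAt) fun t ht => ?_
    rw [interior_Ici] at ht
    rw [(hH t).deriv]
    have := mul_le_mul_of_nonneg_right (hV' t (le_of_lt ht)) (Real.exp_pos (Real.exp (-μ * t) / μ)).le
    simp only [E]
    linarith
  have h1 := hanti self_mem_Ici ht ht
  have h2 : 1 ≤ E t := Real.one_le_exp (by positivity)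
  have h3 : E 0 = Real.exp (1 / μ) := by simp [E]
  have h4 : 0 ≤ V t := hnn _
  have hpΓ : 0 ≤ p * Γ := by positivity
  calc V t ≤ V t + p * Γ := by linarith
    _ ≤ (V t + p * Γ) * E t := le_mul_of_one_le_right (by positivity) h2
    _ ≤ (V 0 + p * Γ) * E 0 := h1
    _ ≤ (p * (z 0 ⬝ᵥ z 0) + p * Γ) * E 0 := by
        have := hle (z 0)
        have h5 : 0 ≤ E 0 := (Real.exp_pos _).le
        gcongr
    _ = _ := by rw [h3]; ring

/-- Cauchy-Schwarz in the form of `P` yields one factor `p` from the column of `B` and another from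
`z`, so a small `p` beats any fixed `D`. -/
theorem abs_feedback_le_one {P : Matrix (Fin n) (Fin n) ℝ} (hP : P.PosDef) {p D : ℝ} (hp : 0 < p)
    (hle : ∀ v, v ⬝ᵥ P *ᵥ v ≤ p * (v ⬝ᵥ v)) {z : Fin n → ℝ} (hz : z ⬝ᵥ P *ᵥ z ≤ p * D)
    (hD : p ^ 2 * ((∑ k, Bᵀ k ⬝ᵥ Bᵀ k) * D) ≤ 1) (k : Fin m) : |(-(Bᵀ * P) *ᵥ z) k| ≤ 1 := by
  have hs := posDef_transpose hP
  have hnn := posDef_dotProduct_nonneg hP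
  have hk : (-(Bᵀ * P) *ᵥ z) k = -(Bᵀ k ⬝ᵥ P *ᵥ z) := by
    rw [Matrix.neg_mulVec, ← Matrix.mulVec_mulVec]; rfl
  rw [hk, abs_neg]
  refine abs_le_of_sq_le_sq ?_ zero_le_one
  have hD0 : 0 ≤ D := by
    have := (hnn z).trans hz
    exact (mul_nonneg_iff_of_pos_left hp).1 this
  have h1 : Bᵀ k ⬝ᵥ Bᵀ k ≤ ∑ k, Bᵀ k ⬝ᵥ Bᵀ k :=
    Finset.single_le_sum (f := fun k => Bᵀ k ⬝ᵥ Bᵀ k)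
      (fun j _ => dotProduct_self_nonneg_real _) (Finset.mem_univ k)
  have h2 := dotProduct_self_nonneg_real (Bᵀ k)
  calc (Bᵀ k ⬝ᵥ P *ᵥ z) ^ 2 ≤ (Bᵀ k ⬝ᵥ P *ᵥ Bᵀ k) * (z ⬝ᵥ P *ᵥ z) :=
        sq_dotProduct_mulVec_le hs hnn _ _
    _ ≤ (p * (Bᵀ k ⬝ᵥ Bᵀ k)) * (p * D) := by
        gcongr
        · exact hnn z
        · exact hle _
    _ ≤ (p * ∑ k, Bᵀ k ⬝ᵥ Bᵀ k) * (p * D) := by gcongr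
    _ ≤ 1 ^ 2 := by linarith

end LowGain

/-! ### The closed loop as a Lipschitz vector field; uniqueness of solutions. -/

section ClosedLoop

variable {N n m nc : ℕ}

theorem sat_of_abs_le_one {w : ℝ} (h : |w| ≤ 1) : sat w = w := by
  rw [sat, min_eq_right h]
  rcases lt_trichotomy w 0 with hw | rfl | hw
  · rw [Real.sign_of_neg hw, abs_of_neg hw]; ring
  · simp
  · rw [Real.sign_of_pos hw, abs_of_pos hw]; ring

/-- The clamp form makes the Lipschitz constant `1` immediate. -/
theorem sat_eq_max_min (w : ℝ) : sat w = max (-1) (min 1 w) := by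
  rcases lt_trichotomy w 0 with hw | rfl | hw
  · rw [sat, Real.sign_of_neg hw, abs_of_neg hw, min_eq_right (by linarith : w ≤ 1), neg_one_mul,
      ← max_neg_neg, neg_neg]
  · simp [sat]
  · rw [sat, Real.sign_of_pos hw, abs_of_pos hw, one_mul, max_eq_right]
    exact (neg_nonpos.2 zero_le_one).trans (le_min zero_le_one hw.le)

theorem lipschitzWith_sat : LipschitzWith 1 sat := by
  have : sat = fun w => max (-1) (min 1 w) := funext sat_eq_max_min
  rw [this]
  exact (LipschitzWith.id.const_min 1).const_max (-1)

theorem lipschitzWith_satVec_pi :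
    LipschitzWith 1 fun (u : Fin N → Fin m → ℝ) i => satVec (u i) :=
  LipschitzWith.of_dist_le_mul fun u v => by
    rw [NNReal.coe_one, one_mul, dist_pi_le_iff dist_nonneg]
    intro i
    rw [dist_pi_le_iff dist_nonneg]
    intro k
    have h1 := lipschitzWith_sat.dist_le_mul (u i k) (v i k)
    rw [NNReal.coe_one, one_mul] at h1
    exact h1.trans ((dist_le_pi_dist (u i) (v i) k).trans (dist_le_pi_dist u v i))

variable (A : Matrix (Fin n) (Fin n) ℝ) (B : Matrix (Fin n) (Fin m) ℝ)
  (K : LinearProtocol n m nc) (G : WeightedGraph N) (C : Finset (Fin N))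

/-- The joint state of the agents, the exosystem and the protocols. -/
abbrev LoopState (N n nc : ℕ) : Type :=
  (Fin N → Fin n → ℝ) × (Fin n → ℝ) × (Fin N → Fin nc → ℝ)

/-- The vector field of the closed loop, linear in the state and the actuator signals. -/
def loopField : LoopState N n nc × (Fin N → Fin m → ℝ) →ₗ[ℝ] LoopState N n nc where
  toFun q := (fun i => A *ᵥ q.1.1 i + B *ᵥ q.2 i, A *ᵥ q.1.2.1, fun i =>
    K.Ac *ᵥ q.1.2.2 i + iota C i • (K.Jc *ᵥ q.1.2.2 i) + K.Bc *ᵥ (K.Fc *ᵥ q.1.2.2 i)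
      + K.Cc *ᵥ zetaBar G C q.1.1 q.1.2.1 i + K.Dc *ᵥ zetaHat G (fun j => K.Ec *ᵥ q.1.2.2 j) i)
  map_add' q r := by
    have h1 : ∀ i, zetaBar G C (q + r).1.1 (q + r).1.2.1 i
        = zetaBar G C q.1.1 q.1.2.1 i + zetaBar G C r.1.1 r.1.2.1 i := fun i => by
      simp only [zetaBar, Prod.fst_add, Prod.snd_add, Pi.add_apply, add_sub_add_comm, smul_add,
        Finset.sum_add_distrib]
      abel
    have h2 : ∀ i, zetaHat G (fun j => K.Ec *ᵥ (q + r).1.2.2 j) i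
        = zetaHat G (fun j => K.Ec *ᵥ q.1.2.2 j) i + zetaHat G (fun j => K.Ec *ᵥ r.1.2.2 j) i :=
      fun i => by
        simp only [zetaHat, Prod.fst_add, Prod.snd_add, Pi.add_apply, Matrix.mulVec_add,
          add_sub_add_comm, smul_add, Finset.sum_add_distrib]
    refine Prod.ext (funext fun i => ?_) (Prod.ext ?_ (funext fun i => ?_))
    · simp only [Prod.fst_add, Prod.snd_add, Pi.add_apply, Matrix.mulVec_add]; abel
    · simp only [Prod.fst_add, Prod.snd_add, Matrix.mulVec_add]
    · simp only [h1, h2]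
      simp only [Prod.fst_add, Prod.snd_add, Pi.add_apply, Matrix.mulVec_add, smul_add]
      abel
  map_smul' c q := by
    have h1 : ∀ i, zetaBar G C (c • q).1.1 (c • q).1.2.1 i
        = c • zetaBar G C q.1.1 q.1.2.1 i := fun i => by
      simp only [zetaBar, Prod.smul_fst, Prod.smul_snd, Pi.smul_apply, ← smul_sub, smul_add,
        Finset.smul_sum, smul_comm c]
    have h2 : ∀ i, zetaHat G (fun j => K.Ec *ᵥ (c • q).1.2.2 j) i
        = c • zetaHat G (fun j => K.Ec *ᵥ q.1.2.2 j) i := fun i => by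
      simp only [zetaHat, Prod.smul_fst, Prod.smul_snd, Pi.smul_apply, Matrix.mulVec_smul,
        ← smul_sub, Finset.smul_sum, smul_comm c]
    refine Prod.ext (funext fun i => ?_) (Prod.ext ?_ (funext fun i => ?_))
    · simp [Matrix.mulVec_smul]
    · simp [Matrix.mulVec_smul]
    · simp only [h1, h2]
      simp only [Prod.smul_fst, Prod.smul_snd, Pi.smul_apply, Matrix.mulVec_smul, smul_add,
        RingHom.id_apply, smul_comm c]

/-- The unsaturated closed loop has a solution on the whole line. -/
theorem exists_unsaturated_solution (x₀ : Fin N → Fin n → ℝ) (xr₀ : Fin n → ℝ)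
    (xc₀ : Fin N → Fin nc → ℝ) : ∃ w : ℝ → LoopState N n nc, w 0 = (x₀, xr₀, xc₀) ∧
      ∀ t, HasDerivAt w (loopField A B K G C (w t, fun i => K.Fc *ᵥ (w t).2.2 i)) t := by
  let Φ : LoopState N n nc →ₗ[ℝ] (Fin N → Fin m → ℝ) :=
    LinearMap.pi fun i => Matrix.mulVecLin K.Fc ∘ₗ LinearMap.proj i ∘ₗ
      LinearMap.snd ℝ _ _ ∘ₗ LinearMap.snd ℝ _ _
  exact exists_linear_flow (loopField A B K G C ∘ₗ LinearMap.id.prod Φ) (x₀, xr₀, xc₀)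

variable {A B K G C}

theorem IsClosedLoopSolution.hasDerivWithinAt {x₀ : Fin N → Fin n → ℝ} {xr₀ : Fin n → ℝ}
    {xc₀ : Fin N → Fin nc → ℝ} {x : Fin N → ℝ → Fin n → ℝ} {xr : ℝ → Fin n → ℝ}
    {xc : Fin N → ℝ → Fin nc → ℝ} (h : IsClosedLoopSolution A B K G C x₀ xr₀ xc₀ x xr xc)
    {t : ℝ} (ht : 0 ≤ t) :
    HasDerivWithinAt (fun t => ((fun i => x i t, xr t, fun i => xc i t) : LoopState N n nc))
      (loopField A B K G C ((fun i => x i t, xr t, fun i => xc i t),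
        fun i => satVec (K.Fc *ᵥ xc i t))) (Ici 0) t :=
  (hasDerivWithinAt_pi.2 fun i => h.agent i t ht).prodMk
    ((h.exo t ht).prodMk (hasDerivWithinAt_pi.2 fun i => h.protocol i t ht))

/-- The saturated closed loop has at most one solution. -/
theorem IsClosedLoopSolution.unique {x₀ : Fin N → Fin n → ℝ} {xr₀ : Fin n → ℝ}
    {xc₀ : Fin N → Fin nc → ℝ} {x x' : Fin N → ℝ → Fin n → ℝ} {xr xr' : ℝ → Fin n → ℝ}
    {xc xc' : Fin N → ℝ → Fin nc → ℝ} (h : IsClosedLoopSolution A B K G C x₀ xr₀ xc₀ x xr xc)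
    (h' : IsClosedLoopSolution A B K G C x₀ xr₀ xc₀ x' xr' xc') {t : ℝ} (ht : 0 ≤ t) :
    (∀ i, x i t = x' i t) ∧ xr t = xr' t ∧ ∀ i, xc i t = xc' i t := by
  let v : LoopState N n nc → LoopState N n nc := fun q =>
    loopField A B K G C (q, fun i => satVec (K.Fc *ᵥ q.2.2 i))
  obtain ⟨c, hc⟩ : ∃ c, LipschitzWith c v := by
    let Φ : LoopState N n nc →ₗ[ℝ] (Fin N → Fin m → ℝ) :=
      LinearMap.pi fun i => Matrix.mulVecLin K.Fc ∘ₗ LinearMap.proj i ∘ₗ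
        LinearMap.snd ℝ _ _ ∘ₗ LinearMap.snd ℝ _ _
    exact ⟨_, (LinearMap.toContinuousLinearMap (loopField A B K G C)).lipschitz.comp
      (LipschitzWith.id.prodMk
        (lipschitzWith_satVec_pi.comp (LinearMap.toContinuousLinearMap Φ).lipschitz))⟩
  have key := ODE_solution_unique (v := fun _ => v) (K := c) (a := 0) (b := t) (fun _ => hc)
    (fun s hs => (h.hasDerivWithinAt hs.1).continuousWithinAt.mono Icc_subset_Ici_self)
    (fun s hs => (h.hasDerivWithinAt hs.1).mono (Ici_subset_Ici.2 hs.1))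
    (fun s hs => (h'.hasDerivWithinAt hs.1).continuousWithinAt.mono Icc_subset_Ici_self)
    (fun s hs => (h'.hasDerivWithinAt hs.1).mono (Ici_subset_Ici.2 hs.1))
    (by simp [h.init_agent, h.init_exo, h.init_protocol, h'.init_agent, h'.init_exo,
      h'.init_protocol]) (right_mem_Icc.2 ht)
  simp only [Prod.mk.injEq] at key
  exact ⟨congrFun key.1, key.2.1, congrFun key.2.2⟩

end ClosedLoop

end RegSync

namespace RegSync

open Filter Topology Set

/-! ### The cascade for the low-gain protocol and the final estimate. -/

section LowGainProtocol

variable {N n m : ℕ}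

theorem exists_zetaBar_bound (G : WeightedGraph N) (C : Finset (Fin N)) (n : ℕ) :
    ∃ c, 0 ≤ c ∧ ∀ (e : Fin N → Fin n → ℝ) (i : Fin N), ‖zetaBar G C e 0 i‖ ≤ c * ‖e‖ := by
  let L : (Fin N → Fin n → ℝ) →ₗ[ℝ] (Fin N → Fin n → ℝ) :=
    let π : Fin N → (Fin N → Fin n → ℝ) →ₗ[ℝ] (Fin n → ℝ) := LinearMap.proj
    LinearMap.pi fun i => ∑ j, G.a i j • (π i - π j) + iota C i • π i
  have hL : ∀ e, L e = zetaBar G C e 0 := fun e => by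
    ext1 i
    simp [L, zetaBar]
  refine ⟨‖LinearMap.toContinuousLinearMap L‖, norm_nonneg _, fun e i => ?_⟩
  rw [← hL]
  exact (norm_le_pi_norm (L e) i).trans ((LinearMap.toContinuousLinearMap L).le_opNorm e)

theorem dotProduct_self_le_norm_sq (v : Fin n → ℝ) : v ⬝ᵥ v ≤ n * ‖v‖ ^ 2 := by
  calc v ⬝ᵥ v ≤ ∑ _i : Fin n, ‖v‖ ^ 2 := Finset.sum_le_sum fun i _ => by
        rw [← sq, ← sq_abs]
        exact pow_le_pow_left₀ (abs_nonneg _) (norm_le_pi_norm v i) 2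
    _ = _ := by simp

/-- The reason for the exchanged variable: the protocol's network input depends only on the errors
`x - xr - χ`, since `xr` cancels in the differences between agents. -/
theorem zetaBar_sub_zetaHat (G : WeightedGraph N) (C : Finset (Fin N)) (x χ : Fin N → Fin n → ℝ)
    (xr : Fin n → ℝ) (i : Fin N) :
    zetaBar G C (fun j => x j - xr - χ j) 0 i
      = zetaBar G C x xr i - zetaHat G χ i - iota C i • χ i := by
  ext k
  simp only [zetaBar, zetaHat, Pi.add_apply, Pi.sub_apply, Finset.sum_apply, Pi.smul_apply,
    smul_eq_mul, Pi.zero_apply]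
  rw [add_sub_right_comm, ← Finset.sum_sub_distrib, add_sub_assoc, ← mul_sub, sub_zero]
  congr 1
  exact Finset.sum_congr rfl fun j _ => by ring

/-- In the coordinates `χ` and `e = x - xr - χ`, the unsaturated closed loop of the low-gain
protocol is a cascade. -/
theorem lowGain_unsaturated_cascade {A : Matrix (Fin n) (Fin n) ℝ} {B : Matrix (Fin n) (Fin m) ℝ}
    {P : Matrix (Fin n) (Fin n) ℝ} {G : WeightedGraph N} {C : Finset (Fin N)}
    {w : ℝ → LoopState N n n} {t : ℝ}
    (hw : HasDerivAt w (loopField A B (lowGainProtocol A B P) G C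
      (w t, fun i => (lowGainProtocol A B P).Fc *ᵥ (w t).2.2 i)) t) :
    HasDerivAt (fun t i => (w t).1 i - (w t).2.1 - (w t).2.2 i)
      (fun i => A *ᵥ ((w t).1 i - (w t).2.1 - (w t).2.2 i)
        - zetaBar G C (fun j => (w t).1 j - (w t).2.1 - (w t).2.2 j) 0 i) t ∧
    ∀ i, HasDerivAt (fun t => (w t).2.2 i) ((A - B * (Bᵀ * P)) *ᵥ (w t).2.2 i
        + zetaBar G C (fun j => (w t).1 j - (w t).2.1 - (w t).2.2 j) 0 i) t := by
  have hx := fun i => hasDerivAt_pi.1 hw.fst i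
  have hxr := hw.snd.fst
  have hχ := fun i => hasDerivAt_pi.1 hw.snd.snd i
  refine ⟨hasDerivAt_pi.2 fun i => (((hx i).sub hxr).sub (hχ i)).congr_deriv ?_,
    fun i => (hχ i).congr_deriv ?_⟩
  · rw [zetaBar_sub_zetaHat]
    simp only [loopField, lowGainProtocol, LinearMap.coe_mk, AddHom.coe_mk, Matrix.mulVec_sub,
      Matrix.neg_mulVec, Matrix.one_mulVec, smul_neg]
    abel
  · rw [zetaBar_sub_zetaHat]
    simp only [loopField, lowGainProtocol, LinearMap.coe_mk, AddHom.coe_mk, Matrix.sub_mulVec,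
      Matrix.neg_mulVec, Matrix.one_mulVec, Matrix.mulVec_neg, smul_neg, Matrix.mulVec_mulVec]
    abel

/-- Semi-global regulation by the low-gain protocol. -/
theorem lowGain_semiGlobal {A : Matrix (Fin n) (Fin n) ℝ} {B : Matrix (Fin n) (Fin m) ℝ}
    (hA : IsAtMostWeaklyUnstable A) (hAB : IsStabilizable A B) {Sa Se Sc : Set (Fin n → ℝ)}
    (hSa : IsCompact Sa) (hSe : IsCompact Se) (hSc : IsCompact Sc) (C : Finset (Fin N))
    (G : WeightedGraph N) (hG : G.HasRootSet C) :
    ∃ εs ∈ Ioc (0 : ℝ) 1, ∀ ε ∈ Ioc (0 : ℝ) εs, ∀ P, IsRiccatiSolution A B ε P →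
      ∀ (x₀ : Fin N → Fin n → ℝ) (xr₀ : Fin n → ℝ) (χ₀ : Fin N → Fin n → ℝ),
        (∀ i, x₀ i ∈ Sa) → xr₀ ∈ Se → (∀ i, χ₀ i ∈ Sc) →
        (∃ x xr χ, IsClosedLoopSolution A B (lowGainProtocol A B P) G C x₀ xr₀ χ₀ x xr χ) ∧
        ∀ x xr χ, IsClosedLoopSolution A B (lowGainProtocol A B P) G C x₀ xr₀ χ₀ x xr χ →
          NeverSaturated (lowGainProtocol A B P) χ ∧ RegulatedSync x xr := by
  obtain ⟨R, hR⟩ := ((hSa.union hSe).union hSc).isBounded.exists_norm_le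
  obtain ⟨c, μ, hc, hμ, hdecay⟩ := exists_error_decay hA hG
  obtain ⟨d, hd, hbar⟩ := exists_zetaBar_bound G C n
  -- All constants precede `ε`: `3 |R|` bounds the initial error, `M` its later size, `Γ` the
  -- squared forcing, and `p * D` the Lyapunov function. Then `p` is chosen so that `p² b D ≤ 1`,
  -- and `εs` so that `P ≤ p I`.
  let M : ℝ := c * (3 * |R|)
  let Γ : ℝ := n * (d * M) ^ 2
  let D : ℝ := (n * |R| ^ 2 + Γ) * Real.exp (1 / μ)
  let b : ℝ := ∑ k, Bᵀ k ⬝ᵥ Bᵀ k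
  have hb : 0 ≤ b := Finset.sum_nonneg fun k _ => dotProduct_self_nonneg_real _
  have hD : 0 ≤ D := by positivity
  let p : ℝ := 1 / (1 + b * D)
  have hp : 0 < p := by positivity
  have hpD : p ^ 2 * (b * D) ≤ 1 := by
    have h0 : 0 ≤ b * D := by positivity
    have h1 : p ≤ 1 := by simp only [p]; rw [div_le_one (by positivity)]; linarith
    have h2 : p * (b * D) ≤ 1 := by
      simp only [p]; rw [one_div_mul_eq_div, div_le_one (by positivity)]; linarith
    calc p ^ 2 * (b * D) = p * (p * (b * D)) := by ring
      _ ≤ 1 * 1 := mul_le_mul h1 h2 (by positivity) zero_le_one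
      _ = 1 := one_mul 1
  obtain ⟨εs, hεs, hsmall⟩ := riccatiSolution_small hA hAB hp
  refine ⟨εs, hεs, fun ε hε P hP x₀ xr₀ χ₀ hx₀ hxr₀ hχ₀ => ?_⟩
  have hle := hsmall ε hε P hP
  -- No bootstrap in time is needed: the linear trajectory exists globally, is shown never to reach
  -- saturation, and so is the unique solution of the saturated loop.
  obtain ⟨w, hw0, hw⟩ := exists_unsaturated_solution A B (lowGainProtocol A B P) G C x₀ xr₀ χ₀
  let e : ℝ → Fin N → Fin n → ℝ := fun t i => (w t).1 i - (w t).2.1 - (w t).2.2 i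
  let χ : Fin N → ℝ → Fin n → ℝ := fun i t => (w t).2.2 i
  have he := fun t => (lowGain_unsaturated_cascade (hw t)).1
  have hχ := fun i t => (lowGain_unsaturated_cascade (hw t)).2 i
  have hχ0 : ∀ i, χ i 0 = χ₀ i := fun i => by simp [χ, hw0]
  have hRχ : ∀ i, ‖χ₀ i‖ ≤ |R| := fun i => (hR _ (Or.inr (hχ₀ i))).trans (le_abs_self R)
  have he0 : ‖e 0‖ ≤ 3 * |R| := by
    rw [pi_norm_le_iff_of_nonneg (by positivity)]
    intro i
    have h1 : ‖x₀ i‖ ≤ |R| := (hR _ (Or.inl (Or.inl (hx₀ i)))).trans (le_abs_self R)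
    have h2 : ‖xr₀‖ ≤ |R| := (hR _ (Or.inl (Or.inr hxr₀))).trans (le_abs_self R)
    have h3 := hRχ i
    have h4 : e 0 i = x₀ i - xr₀ - χ₀ i := by simp [e, hw0]
    rw [h4]
    have h5 := norm_sub_le (x₀ i - xr₀) (χ₀ i)
    have h6 := norm_sub_le (x₀ i) xr₀
    linarith
  have het : ∀ t, 0 ≤ t → ‖e t‖ ≤ M * Real.exp (-μ * t) := fun t ht =>
    (hdecay e he t ht).trans (by simp only [M]; gcongr)
  have hg : ∀ i t, 0 ≤ t →
      zetaBar G C (e t) 0 i ⬝ᵥ zetaBar G C (e t) 0 i ≤ Γ * Real.exp (-(2 * μ) * t) := by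
    intro i t ht
    have h1 : ‖zetaBar G C (e t) 0 i‖ ≤ d * (M * Real.exp (-μ * t)) :=
      (hbar _ i).trans (mul_le_mul_of_nonneg_left (het t ht) hd)
    have h2 : Real.exp (-(2 * μ) * t) = Real.exp (-μ * t) ^ 2 := by
      rw [← Real.exp_nat_mul]; push_cast; ring_nf
    calc _ ≤ n * ‖zetaBar G C (e t) 0 i‖ ^ 2 := dotProduct_self_le_norm_sq _
      _ ≤ n * (d * (M * Real.exp (-μ * t))) ^ 2 := by gcongr
      _ = _ := by rw [h2]; simp only [Γ]; ring
  have hunsat : ∀ i t, 0 ≤ t → satVec ((lowGainProtocol A B P).Fc *ᵥ χ i t)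
      = (lowGainProtocol A B P).Fc *ᵥ χ i t := by
    intro i t ht
    have h1 := hP.form_le hε.1 hp hμ hle (hχ i) (hg i) ht
    have h2 : χ i t ⬝ᵥ P *ᵥ χ i t ≤ p * D := by
      refine h1.trans ?_
      simp only [D]
      rw [mul_assoc]
      gcongr
      rw [show (w 0).2.2 i = χ₀ i from hχ0 i]
      exact (dotProduct_self_le_norm_sq _).trans (by gcongr; exact hRχ i)
    exact funext fun k => sat_of_abs_le_one (abs_feedback_le_one hP.1 hp hle h2 hpD k)
  have hsol : IsClosedLoopSolution A B (lowGainProtocol A B P) G C x₀ xr₀ χ₀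
      (fun i t => (w t).1 i) (fun t => (w t).2.1) χ :=
    { init_agent := fun i => by simp [hw0]
      init_exo := by simp [hw0]
      init_protocol := hχ0
      agent := fun i t ht => by
        rw [hunsat i t ht]
        exact (hasDerivAt_pi.1 (hw t).fst i).hasDerivWithinAt
      exo := fun t _ =>
        have hxr : HasDerivAt (fun t => (w t).2.1) (A *ᵥ (w t).2.1) t := (hw t).snd.fst
        hxr.hasDerivWithinAt
      protocol := fun i t _ => (hasDerivAt_pi.1 (hw t).snd.snd i).hasDerivWithinAt }
  refine ⟨⟨_, _, _, hsol⟩, fun x xr χ' h => ⟨fun i t ht => ?_, fun i => ?_⟩⟩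
  · rw [(h.unique hsol ht).2.2 i]
    exact hunsat i t ht
  · have hχlim : Tendsto (χ i) atTop (𝓝 0) :=
      tendsto_zero_of_lyapunov hP.1 hε.1 hP.closed_loop_le (by positivity : 0 < 2 * μ) (hχ i) (hg i)
    have helim : Tendsto e atTop (𝓝 0) := by
      refine squeeze_zero_norm' ((eventually_ge_atTop 0).mono fun t ht => het t ht) ?_
      have : Tendsto (fun t : ℝ => Real.exp (-μ * t)) atTop (𝓝 0) :=
        Real.tendsto_exp_atBot.comp (tendsto_id.const_mul_atTop_of_neg (neg_lt_zero.2 hμ))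
      simpa using this.const_mul M
    -- The tracking error `x - xr` is `e + χ`.
    have hsum := (tendsto_pi_nhds.1 helim i).add hχlim
    rw [Pi.zero_apply, add_zero] at hsum
    refine hsum.congr' ((eventually_ge_atTop 0).mono fun t ht => ?_)
    obtain ⟨h1, h2, -⟩ := h.unique hsol ht
    simp only [h1, h2, e, χ]
    abel

end LowGainProtocol

end RegSync

theorem theorem3 {n m : ℕ} (A : Matrix (Fin n) (Fin n) ℝ) (B : Matrix (Fin n) (Fin m) ℝ)
    (hA : RegSync.IsAtMostWeaklyUnstable A) (hAB : RegSync.IsStabilizable A B) :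
    RegSync.SemiGlobalProblemSolvable A B ∧
    (∀ ε : ℝ, 0 < ε →
      ∃! P : Matrix (Fin n) (Fin n) ℝ, RegSync.IsRiccatiSolution A B ε P) ∧
    ∀ Sa Se Sc : Set (Fin n → ℝ), IsCompact Sa → IsCompact Se → IsCompact Sc →
      ∀ (N : ℕ) (C : Finset (Fin N)) (G : RegSync.WeightedGraph N), G.HasRootSet C →
      ∃ εs ∈ Set.Ioc (0 : ℝ) 1, ∀ ε ∈ Set.Ioc (0 : ℝ) εs,
      ∀ P : Matrix (Fin n) (Fin n) ℝ, RegSync.IsRiccatiSolution A B ε P →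
      ∀ (x₀ : Fin N → Fin n → ℝ) (xr₀ : Fin n → ℝ) (χ₀ : Fin N → Fin n → ℝ),
        (∀ i, x₀ i ∈ Sa) → xr₀ ∈ Se → (∀ i, χ₀ i ∈ Sc) →
        (∃ x xr χ, RegSync.IsClosedLoopSolution A B (RegSync.lowGainProtocol A B P) G C
          x₀ xr₀ χ₀ x xr χ) ∧
        ∀ x xr χ, RegSync.IsClosedLoopSolution A B (RegSync.lowGainProtocol A B P) G C
            x₀ xr₀ χ₀ x xr χ →
          RegSync.NeverSaturated (RegSync.lowGainProtocol A B P) χ ∧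
          RegSync.RegulatedSync x xr := by
  have hlow := fun Sa Se Sc (hSa : IsCompact Sa) (hSe : IsCompact Se) (hSc : IsCompact Sc)
    (N : ℕ) (C : Finset (Fin N)) (G : RegSync.WeightedGraph N) (hG : G.HasRootSet C) =>
      RegSync.lowGain_semiGlobal hA hAB hSa hSe hSc C G hG
  have hex : ∀ ε : ℝ, 0 < ε → ∃ P, RegSync.IsRiccatiSolution A B ε P := fun ε hε =>
    RegSync.exists_riccatiSolution hAB hε
  refine ⟨?_, fun ε hε => ?_, hlow⟩
  · have hex' : ∀ ε : ℝ, ∃ P, 0 < ε → RegSync.IsRiccatiSolution A B ε P := fun ε => by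
      by_cases h : 0 < ε
      · obtain ⟨P, hP⟩ := hex ε h
        exact ⟨P, fun _ => hP⟩
      · exact ⟨0, fun h' => absurd h' h⟩
    choose P hP using hex'
    refine ⟨n, fun ε => RegSync.lowGainProtocol A B (P ε), ⟨1, fun _ _ => rfl⟩, ?_⟩
    intro Sa Se Sc hSa hSe hSc N C G hG
    obtain ⟨εs, hεs, h⟩ := hlow Sa Se Sc hSa hSe hSc N C G hG
    refine ⟨εs, hεs, fun ε hε x₀ xr₀ xc₀ hx hxr hxc => ?_⟩
    obtain ⟨h1, h2⟩ := h ε hε (P ε) (hP ε hε.1) x₀ xr₀ xc₀ hx hxr hxc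
    exact ⟨h1, fun x xr xc hs => (h2 x xr xc hs).2⟩
  · obtain ⟨P, hP⟩ := hex ε hε
    exact ⟨P, hP, fun Q hQ => hQ.unique hε hP⟩
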